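/- Let $(R,\mathfrak m)$ be a regular (Noetherian) local ring of Krull dimension $2$, and let $I$ be a full $\mathfrak m$-primary ideal of $R$. Then the limit $$\operatorname{e}(I)=\lim_{n\to\infty}\frac{2!\,\ell(R/I^n)}{n^2}$$ (the Hilbert–Samuel multiplicity of $I$, where $\ell$ denotes length) exists and $$\operatorname{e}(I)\ \le\ \ell\ell(I)\,(\mu(I)-1)\ =\ \ell\ell(I)\cdot\operatorname{ord}(I).$$ Here $\ell\ell(I)$ is the Loewy length of $R/I$, i.e. the smallest integer $n$ with $\mathfrak m^n\subseteq I$; $\mu(I)$ is the minimal number of generators of $I$; and $\operatorname{ord}(I)$ is the largest integer $s$ with $I\subseteq\mathfrak m^s$. The ideal $I$ is called full if there is $z\in\mathfrak m$ with $I:z=I:\mathfrak m$ or, more generally (as is needed when the residue field of $R$ is finite), if there is a faithfully flat extension $R\to S$, where $S$ is a Noetherian local ring with infinite residue field and maximal ideal $\mathfrak mS$, and an element $z\in\mathfrak mS$ with $IS:_S z=IS:_S\mathfrak mS$. -/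

import Mathlib

open IsLocalRing Filter Topology
open scoped Nat

universe u v

noncomputable section

/-- The Loewy length of `R ⧸ I`: the smallest `n` such that `𝔪 ^ n ⊆ I`. -/
def loewyLength {R : Type u} [CommRing R] [IsLocalRing R] (I : Ideal R) : ℕ :=
  sInf {n : ℕ | maximalIdeal R ^ n ≤ I}

/-- The order of `I`: the largest `s` such that `I ⊆ 𝔪 ^ s`. -/
def idealOrder {R : Type u} [CommRing R] [IsLocalRing R] (I : Ideal R) : ℕ :=
  sSup {s : ℕ | I ≤ maximalIdeal R ^ s}

/-- The sequence `d! · ℓ(R ⧸ I ^ n) / n ^ d`, where `d` is the Krull dimension of `R`. -/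
def normalizedHilbertSamuel {R : Type u} [CommRing R] (I : Ideal R) (n : ℕ) : ℝ :=
  let d : ℕ := ((ringKrullDim R).unbotD 0).toNat
  ((d ! : ℕ) : ℝ) * ((Module.length R (R ⧸ I ^ n)).toNat : ℝ) / (n : ℝ) ^ d

/-- The Hilbert-Samuel multiplicity `e(I) = lim d! · ℓ(R ⧸ I ^ n) / n ^ d`. -/
def hilbertSamuelMultiplicity {R : Type u} [CommRing R] (I : Ideal R) : ℝ :=
  limUnder atTop (normalizedHilbertSamuel I)

/-- There is `z ∈ 𝔪` with `I : z = I : 𝔪`. -/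
def HasFullElement {R : Type u} [CommRing R] [IsLocalRing R] (I : Ideal R) : Prop :=
  ∃ z ∈ maximalIdeal R, I.colon {z} = I.colon (maximalIdeal R : Set R)

/-- `I` is full: there is `z ∈ 𝔪` with `I : z = I : 𝔪`, or such an element exists after a
faithfully flat extension `R → S` of Noetherian local rings, with infinite residue field of `S`,
such that `𝔪 S` is the maximal ideal of `S`. The second alternative is there for rings whose
residue field is finite. -/
def IsFull {R : Type u} [CommRing R] [IsLocalRing R] (I : Ideal R) : Prop :=
  HasFullElement I ∨
    ∃ (S : Type v) (_ : CommRing S) (_ : IsLocalRing S) (_ : IsNoetherianRing S)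
      (_ : Algebra R S),
      Module.FaithfullyFlat R S ∧ Infinite (ResidueField S) ∧
      (maximalIdeal R).map (algebraMap R S) = maximalIdeal S ∧
      HasFullElement (I.map (algebraMap R S))

end

/-! Write 𝔪 = (x, y) with x, y a regular sequence. The Koszul complex on R/J gives μ(J) + ℓ(R/(J:𝔪))
= ℓ(R/J) + 1. Comparing with ℓ(R/J) = ℓ(R/(J:z)) + ℓ(R/(J,z)) gives μ(J) ≤ ℓ(R/(J,z)) + 1 for every
z ∈ 𝔪, with equality when J:z = J:𝔪 (`IsRegularPair.spanFinrank_le`,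
`IsRegularPair.spanFinrank_eq`).

Multiplicity bound: a full element z can be chosen outside 𝔪², so R/z has principal maximal ideal
and (J,z) = (a,z) with a ∈ J. If 𝔪^n ⊆ J, then a·J^k ⊆ J^(k+1) and z^(n(k+1)) ∈ J^(k+1), so
ℓ(R/J^(k+1)) ≤ ℓ(R/J^k) + n(k+1)·ℓ(R/(a,z)). Summing, 2ℓ(R/J^k) ≤ n(μ(J)-1)k(k+1)
(`IsLocalRing.colength_pow_mul_two_le`).

Order: J ⊆ 𝔪^s forces ℓ(R/(J,z)) ≥ s, hence μ ≥ ord + 1 for full J. Conversely, over an infinite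
residue field a general linear z has ℓ(R/(J,z)) ≤ ord, hence μ ≤ ord + 1
(`IsRegularPair.exists_spanFinrank_le`).

Limit: over an infinite residue field J has a two-generated reduction Q with J^(n+C) ⊆ Q^n ⊆ J^n. As
Q is generated by a regular sequence, 2ℓ(R/Q^n) = ℓ(R/Q)n(n+1), and the limit is squeezed to ℓ(R/Q).
Flat base change to R[X] localized at 𝔪R[X] supplies the infinite residue field without changing
lengths, μ or order. -/

/-- The length of `R ⧸ J` as an `R`-module. -/
noncomputable def Ideal.colength {R : Type*} [CommRing R] (J : Ideal R) : ℕ∞ :=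
  Module.length R (R ⧸ J)

/-! ### Colengths and colon ideals -/

section Colength

variable {R : Type*} [CommRing R]

theorem Ideal.colength_anti {J K : Ideal R} (h : J ≤ K) : K.colength ≤ J.colength :=
  Module.length_le_of_surjective (Submodule.factor h) (Submodule.factor_surjective h)

theorem Ideal.colength_top : (⊤ : Ideal R).colength = 0 :=
  Module.length_eq_zero_iff.mpr (Ideal.Quotient.subsingleton_iff.mpr rfl)

/-- The exact sequence `0 → R ⧸ (J : z) → R ⧸ J → R ⧸ (J, z) → 0`, in terms of lengths. -/
theorem Ideal.colength_eq_colon_add (J : Ideal R) (z : R) :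
    J.colength = Ideal.colength (J.colon {z}) + (J ⊔ Ideal.span {z}).colength := by
  have hmk : ∀ K : Ideal R, ∀ r, (Submodule.Quotient.mk r : R ⧸ K) = 0 ↔ r ∈ K :=
    fun K r ↦ Submodule.Quotient.mk_eq_zero K
  have hker : (J.mkQ ∘ₗ LinearMap.mulRight R z).ker = J.colon {z} := by
    ext r
    exact (hmk J (r * z)).trans Submodule.mem_colon_singleton.symm
  refine Module.length_eq_add_of_exact (Submodule.liftQ _ _ hker.ge)
    (Submodule.factor (le_sup_left : J ≤ J ⊔ Ideal.span {z})) ?_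
    (Submodule.factor_surjective _) ?_
  · rw [← LinearMap.ker_eq_bot, Submodule.ker_liftQ_eq_bot _ _ _ hker.le]
  · intro q
    obtain ⟨r, rfl⟩ := Submodule.mkQ_surjective _ q
    constructor
    · intro h
      have h : r ∈ J ⊔ Ideal.span {z} := (hmk _ r).mp h
      obtain ⟨j, hj, w, hw, rfl⟩ := Submodule.mem_sup.mp h
      obtain ⟨c, rfl⟩ := Ideal.mem_span_singleton'.mp hw
      refine ⟨Submodule.Quotient.mk c, (Submodule.Quotient.eq J).mpr ?_⟩
      have : c * z - (j + c * z) = -j := by ring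
      change c * z - (j + c * z) ∈ J
      rw [this]
      exact neg_mem hj
    · rintro ⟨c, hc⟩
      obtain ⟨c, rfl⟩ := Submodule.mkQ_surjective _ c
      rw [← hc]
      exact (hmk _ (c * z)).mpr
        (Ideal.mem_sup_right (Ideal.mul_mem_left _ _ (Ideal.mem_span_singleton_self z)))

theorem Ideal.colength_le_add_of_colon_le {J K L : Ideal R} (z : R)
    (hK : ∀ r ∈ K, r * z ∈ J) (hL : L ≤ J ⊔ Ideal.span {z}) :
    J.colength ≤ K.colength + L.colength := by
  rw [J.colength_eq_colon_add z]
  gcongr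
  · exact Ideal.colength_anti fun r hr ↦ Submodule.mem_colon_singleton.mpr (hK r hr)
  · exact Ideal.colength_anti hL

theorem Ideal.colength_span_pair_pow_le (a b : R) (n : ℕ) :
    (Ideal.span {a, b ^ n}).colength ≤ n * (Ideal.span {a, b}).colength := by
  induction n with
  | zero =>
    have : Ideal.span {a, b ^ 0} = ⊤ :=
      Ideal.eq_top_of_isUnit_mem _ (Ideal.subset_span (by simp : b ^ 0 ∈ _)) (by simp)
    rw [this, Ideal.colength_top]
    exact zero_le
  | succ n ih =>
    refine (Ideal.colength_le_add_of_colon_le b (K := Ideal.span {a, b ^ n})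
      (L := Ideal.span {a, b}) ?_ ?_).trans ?_
    · intro r hr
      obtain ⟨c, d, rfl⟩ := Ideal.mem_span_pair.mp hr
      exact Ideal.mem_span_pair.mpr ⟨c * b, d, by ring⟩
    · rw [Ideal.span_insert]
      exact sup_le_sup_right (Ideal.span_mono (by simp)) _
    · push_cast
      rw [add_mul, one_mul]
      gcongr

theorem Ideal.colength_colon_ne_top {J : Ideal R} (hJ : J.colength ≠ ⊤) (s : Set R) :
    Ideal.colength (J.colon s) ≠ ⊤ :=
  ne_top_of_le_ne_top hJ <| Ideal.colength_anti fun _ hr ↦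
    Submodule.mem_colon.mpr fun t _ ↦ J.mul_mem_right t hr

end Colength

/-! ### Numbers of generators and the Koszul complex -/

section LocalColength

variable {R : Type*} [CommRing R] [IsLocalRing R]

theorem IsLocalRing.colength_maximalIdeal : (maximalIdeal R).colength = 1 :=
  Module.length_eq_one_iff.mpr (isSimpleModule_iff_isCoatom.mpr
    (Ideal.isMaximal_def.mp inferInstance))

theorem IsLocalRing.colength_ne_top_of_pow_le {x y : R} (hm : maximalIdeal R = Ideal.span {x, y})
    {J : Ideal R} {n : ℕ} (hJ : maximalIdeal R ^ n ≤ J) : J.colength ≠ ⊤ := by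
  have hx : x ∈ maximalIdeal R := hm ▸ Ideal.subset_span (by simp)
  have hy : y ∈ maximalIdeal R := hm ▸ Ideal.subset_span (by simp)
  have h1 : Ideal.span {x ^ n, y ^ n} ≤ J := by
    rw [Ideal.span_le]
    rintro _ (rfl | rfl)
    exacts [hJ (Ideal.pow_mem_pow hx n), hJ (Ideal.pow_mem_pow hy n)]
  have h2 := Ideal.colength_span_pair_pow_le y x n
  rw [Set.pair_comm y x, ← hm, colength_maximalIdeal, Set.pair_comm] at h2
  have h3 := (Ideal.colength_anti h1).trans (Ideal.colength_span_pair_pow_le (x ^ n) y n)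
  refine ne_top_of_le_ne_top (b := (n : ℕ∞) * (n * 1)) ?_ (h3.trans (by gcongr))
  exact_mod_cast ENat.natCast_ne_top (n * (n * 1))

/-- `ℓ(R ⧸ 𝔪J) = ℓ(R ⧸ J) + μ(J)`. -/
theorem IsLocalRing.colength_maximalIdeal_mul {J : Ideal R} (hJ : J.FG) :
    (maximalIdeal R * J).colength = J.spanFinrank + J.colength := by
  have hlen : Module.length R (J ⧸ maximalIdeal R • (⊤ : Submodule R J)) = J.spanFinrank := by
    have : Module.Finite R J := Module.Finite.iff_fg.mpr hJ
    let _ : Field (R ⧸ maximalIdeal R) := Ideal.Quotient.field _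
    have : Module.Finite (R ⧸ maximalIdeal R) (J ⧸ maximalIdeal R • (⊤ : Submodule R J)) :=
      Module.Finite.of_restrictScalars_finite R _ _
    rw [spanFinrank_eq_finrank_quotient J hJ, ← Module.length_eq_finrank]
    exact Module.length_eq_of_surjective Ideal.Quotient.mk_surjective
  have hle : maximalIdeal R • (⊤ : Submodule R J) ≤
      Submodule.comap J.subtype (maximalIdeal R * J) := by
    rw [← Submodule.map_le_iff_le_comap, Submodule.map_smul'', Submodule.map_top,
      Submodule.range_subtype]
    exact le_rfl
  have hge : Submodule.comap J.subtype (maximalIdeal R * J) ≤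
      maximalIdeal R • (⊤ : Submodule R J) := by
    intro r hr
    have : (r : R) ∈ Submodule.map J.subtype (maximalIdeal R • (⊤ : Submodule R J)) := by
      rw [Submodule.map_smul'', Submodule.map_top, Submodule.range_subtype]
      exact hr
    obtain ⟨s, hs, hsr⟩ := this
    rwa [← Subtype.ext hsr]
  rw [← hlen]
  refine Module.length_eq_add_of_exact (Submodule.mapQ _ _ J.subtype hle)
    (Submodule.factor (Ideal.mul_le_right : maximalIdeal R * J ≤ J)) ?_
    (Submodule.factor_surjective _) ?_
  · rw [← LinearMap.ker_eq_bot, Submodule.mapQ, Submodule.ker_liftQ_eq_bot]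
    intro r hr
    apply hge
    exact (Submodule.Quotient.mk_eq_zero (maximalIdeal R * J)).mp hr
  · intro q
    obtain ⟨r, rfl⟩ := Submodule.mkQ_surjective _ q
    constructor
    · intro h
      have h : r ∈ J := (Submodule.Quotient.mk_eq_zero J).mp h
      exact ⟨Submodule.Quotient.mk ⟨r, h⟩, rfl⟩
    · rintro ⟨c, hc⟩
      obtain ⟨c, rfl⟩ := Submodule.mkQ_surjective _ c
      rw [← hc]
      exact (Submodule.Quotient.mk_eq_zero J).mpr c.2

/-- The maximal ideal is generated by the regular sequence `x, y`. -/
structure IsRegularPair (x y : R) : Prop where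
  maximalIdeal_eq : maximalIdeal R = Ideal.span {x, y}
  left : ∀ c, x * c = 0 → c = 0
  right : ∀ c, x ∣ y * c → x ∣ c

/-- The Koszul complex of `x, y` with coefficients in `R ⧸ J`, in terms of lengths. -/
theorem IsRegularPair.colength_mul_add_colength_colon {x y : R} (h : IsRegularPair x y)
    (J : Ideal R) :
    (maximalIdeal R * J).colength + Ideal.colength (J.colon (maximalIdeal R : Set R)) =
      J.colength + J.colength + 1 := by
  set m := maximalIdeal R with hm_def
  have hm : m = Ideal.span {x, y} := h.maximalIdeal_eq
  have hx : x ∈ m := hm ▸ Ideal.subset_span (by simp)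
  have hy : y ∈ m := hm ▸ Ideal.subset_span (by simp)
  have hmJ : ∀ r, r ∈ m * J ↔ ∃ c ∈ J, ∃ d ∈ J, x * c + y * d = r := by
    intro r
    rw [hm, Ideal.span_insert, Ideal.sup_mul, Submodule.mem_sup]
    constructor
    · rintro ⟨_, h1, _, h2, rfl⟩
      obtain ⟨c, hc, rfl⟩ := Ideal.mem_span_singleton_mul.mp h1
      obtain ⟨d, hd, rfl⟩ := Ideal.mem_span_singleton_mul.mp h2
      exact ⟨c, hc, d, hd, rfl⟩
    · rintro ⟨c, hc, d, hd, rfl⟩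
      exact ⟨_, Ideal.mem_span_singleton_mul.mpr ⟨c, hc, rfl⟩, _,
        Ideal.mem_span_singleton_mul.mpr ⟨d, hd, rfl⟩, rfl⟩
  have hcolon : ∀ r, r ∈ J.colon (m : Set R) ↔ y * r ∈ J ∧ x * r ∈ J := by
    intro r
    rw [Submodule.mem_colon]
    constructor
    · intro hr
      exact ⟨by simpa [mul_comm] using hr y hy, by simpa [mul_comm] using hr x hx⟩
    · rintro ⟨h1, h2⟩ s hs
      rw [SetLike.mem_coe, hm] at hs
      obtain ⟨c, d, rfl⟩ := Ideal.mem_span_pair.mp hs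
      have : r • (c * x + d * y) = c * (x * r) + d * (y * r) := by rw [smul_eq_mul]; ring
      rw [this]
      exact add_mem (J.mul_mem_left _ h2) (J.mul_mem_left _ h1)
  -- the submodule `m / mJ` of `R / mJ`
  let M : Submodule R (R ⧸ m * J) := Submodule.map (m * J).mkQ m
  have hM : (m * J).colength = Module.length R M + 1 := by
    have e : Module.length R ((R ⧸ m * J) ⧸ M) = 1 := by
      rw [(Submodule.quotientQuotientEquivQuotient (m * J) m Ideal.mul_le_left).length_eq]
      exact colength_maximalIdeal
    rw [← e]
    exact Module.length_eq_add_of_exact M.subtype M.mkQ (Submodule.subtype_injective _)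
      (Submodule.mkQ_surjective _) (LinearMap.exact_subtype_mkQ M)
  have hle1 : J ≤ ((m * J).mkQ ∘ₗ LinearMap.mulLeft R x).ker := fun r hr ↦ by
    simp only [LinearMap.mem_ker, LinearMap.comp_apply, Submodule.mkQ_apply,
      Submodule.Quotient.mk_eq_zero, LinearMap.mulLeft_apply]
    exact Ideal.mul_mem_mul hx hr
  have hle2 : J ≤ ((m * J).mkQ ∘ₗ LinearMap.mulLeft R y).ker := fun r hr ↦ by
    simp only [LinearMap.mem_ker, LinearMap.comp_apply, Submodule.mkQ_apply,
      Submodule.Quotient.mk_eq_zero, LinearMap.mulLeft_apply]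
    exact Ideal.mul_mem_mul hy hr
  -- Exact sequence 0 → R/(J:𝔪) → (R/J)² → 𝔪/𝔪J → 0 with maps r ↦ (yr, -xr) and (a, b) ↦ xa + yb.
  let g : ((R ⧸ J) × (R ⧸ J)) →ₗ[R] (R ⧸ m * J) :=
    (Submodule.liftQ J _ hle1).coprod (Submodule.liftQ J _ hle2)
  have hg : ∀ a b : R, g (Submodule.Quotient.mk a, Submodule.Quotient.mk b) =
      Submodule.Quotient.mk (x * a + y * b) := fun a b ↦ rfl
  have hgM : ∀ p, g p ∈ M := by
    rintro ⟨a, b⟩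
    obtain ⟨a, rfl⟩ := Submodule.mkQ_surjective _ a
    obtain ⟨b, rfl⟩ := Submodule.mkQ_surjective _ b
    exact ⟨x * a + y * b, add_mem (m.mul_mem_right _ hx) (m.mul_mem_right _ hy), rfl⟩
  let f0 : R →ₗ[R] ((R ⧸ J) × (R ⧸ J)) :=
    (J.mkQ ∘ₗ LinearMap.mulLeft R y).prod (-(J.mkQ ∘ₗ LinearMap.mulLeft R x))
  have hf0 : ∀ r, f0 r = (Submodule.Quotient.mk (y * r), -Submodule.Quotient.mk (x * r)) :=
    fun r ↦ rfl
  have hker : f0.ker = J.colon (m : Set R) := by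
    ext r
    rw [hcolon, LinearMap.mem_ker, hf0, Prod.mk_eq_zero, neg_eq_zero,
      Submodule.Quotient.mk_eq_zero, Submodule.Quotient.mk_eq_zero]
  have key : Module.length R ((R ⧸ J) × (R ⧸ J)) =
      Ideal.colength (J.colon (m : Set R)) + Module.length R M := by
    refine Module.length_eq_add_of_exact (Submodule.liftQ _ f0 hker.ge) (g.codRestrict M hgM)
      ?_ ?_ ?_
    · rw [← LinearMap.ker_eq_bot, Submodule.ker_liftQ_eq_bot _ _ _ hker.le]
    · rintro ⟨_, r, hr, rfl⟩
      rw [SetLike.mem_coe, hm] at hr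
      obtain ⟨c, d, rfl⟩ := Ideal.mem_span_pair.mp hr
      refine ⟨(Submodule.Quotient.mk c, Submodule.Quotient.mk d), Subtype.ext ?_⟩
      rw [LinearMap.codRestrict_apply, hg, mul_comm x, mul_comm y]
      rfl
    · rintro ⟨a, b⟩
      obtain ⟨a, rfl⟩ := Submodule.mkQ_surjective _ a
      obtain ⟨b, rfl⟩ := Submodule.mkQ_surjective _ b
      constructor
      · intro h0
        have h0 : g (Submodule.Quotient.mk a, Submodule.Quotient.mk b) = 0 :=
          congrArg Subtype.val h0
        rw [hg, Submodule.Quotient.mk_eq_zero, hmJ] at h0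
        obtain ⟨c, hc, d, hd, hcd⟩ := h0
        -- The relation x(a-c) = y(d-b) is a Koszul syzygy, so (a, b) ≡ (ye, -xe) modulo J.
        obtain ⟨e, he⟩ : x ∣ d - b := h.right _ ⟨a - c, by linear_combination hcd⟩
        have h1 : a - c - y * e = 0 := h.left _ (by linear_combination (-hcd) + y * he)
        refine ⟨Submodule.Quotient.mk e, ?_⟩
        change f0 e = _
        rw [hf0, ← Submodule.Quotient.mk_neg]
        refine Prod.ext ((Submodule.Quotient.eq J).mpr ?_) ((Submodule.Quotient.eq J).mpr ?_)
        · have : y * e - a = -c := by linear_combination -h1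
          rw [this]
          exact neg_mem hc
        · have : -(x * e) - b = -d := by linear_combination he
          rw [this]
          exact neg_mem hd
      · rintro ⟨e, he⟩
        obtain ⟨e, rfl⟩ := Submodule.mkQ_surjective _ e
        rw [← he]
        apply Subtype.ext
        change g (f0 e) = 0
        rw [hf0, ← Submodule.Quotient.mk_neg, hg]
        have : x * (y * e) + y * -(x * e) = 0 := by ring
        rw [this, Submodule.Quotient.mk_zero]
  rw [Module.length_prod] at key
  change J.colength + J.colength = _ at key
  rw [hM, key]
  ring

/-- Substitute ℓ(R/𝔪J) = μ(J) + ℓ(R/J) in the Koszul identity and cancel one finite ℓ(R/J). -/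
theorem IsRegularPair.spanFinrank_add_colength_colon {x y : R} (h : IsRegularPair x y)
    {J : Ideal R} (hJ : J.FG) {n : ℕ} (hn : maximalIdeal R ^ n ≤ J) :
    J.spanFinrank + Ideal.colength (J.colon (maximalIdeal R : Set R)) = J.colength + 1 := by
  have h1 := h.colength_mul_add_colength_colon J
  have hfin := colength_ne_top_of_pow_le h.maximalIdeal_eq hn
  rw [colength_maximalIdeal_mul hJ] at h1
  refine ENat.add_right_injective_of_ne_top hfin ?_
  change _ + _ = _ + _
  rw [← add_assoc, ← add_assoc, ← h1]
  ring

/-- Since J:𝔪 ⊆ J:z, replacing the former by the latter in the Koszul identity can only lose length.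
-/
theorem IsRegularPair.spanFinrank_le {x y : R} (h : IsRegularPair x y)
    {J : Ideal R} (hJ : J.FG) {n : ℕ} (hn : maximalIdeal R ^ n ≤ J) {z : R}
    (hz : z ∈ maximalIdeal R) :
    (J.spanFinrank : ℕ∞) ≤ (J ⊔ Ideal.span {z}).colength + 1 := by
  have h1 := h.spanFinrank_add_colength_colon hJ hn
  have hfin := colength_ne_top_of_pow_le h.maximalIdeal_eq hn
  have h2 := J.colength_eq_colon_add z
  have h3 : Ideal.colength (J.colon {z}) ≤ Ideal.colength (J.colon (maximalIdeal R : Set R)) :=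
    Ideal.colength_anti (Submodule.colon_mono le_rfl (by simpa using hz))
  have hfin' := Ideal.colength_colon_ne_top hfin (maximalIdeal R : Set R)
  refine (ENat.add_le_add_iff_right hfin').mp ?_
  rw [h1, h2, add_assoc, add_comm]
  exact add_le_add_right h3 _

theorem IsRegularPair.spanFinrank_eq {x y : R} (h : IsRegularPair x y)
    {J : Ideal R} (hJ : J.FG) {n : ℕ} (hn : maximalIdeal R ^ n ≤ J) {z : R}
    (hz : J.colon {z} = J.colon (maximalIdeal R : Set R)) :
    (J.spanFinrank : ℕ∞) = (J ⊔ Ideal.span {z}).colength + 1 := by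
  have h1 := h.spanFinrank_add_colength_colon hJ hn
  have hfin := colength_ne_top_of_pow_le h.maximalIdeal_eq hn
  have h2 := J.colength_eq_colon_add z
  have hfin' := Ideal.colength_colon_ne_top hfin (maximalIdeal R : Set R)
  refine ENat.add_left_injective_of_ne_top hfin' ?_
  change _ + _ = _ + _
  rw [h1, h2, hz]
  ring

end LocalColength

/-! ### Local rings with principal maximal ideal -/

section PrincipalMaximalIdeal

variable {A : Type*} [CommRing A] [IsLocalRing A]

/-- By Krull's intersection theorem r lies in a last power of 𝔪 = (y). -/
theorem IsLocalRing.exists_eq_pow_mul_unit [IsNoetherianRing A] {y : A}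
    (hy : maximalIdeal A = Ideal.span {y}) {r : A} (hr : r ≠ 0) :
    ∃ k u, IsUnit u ∧ r = y ^ k * u := by
  classical
  have h : ∃ k, r ∉ maximalIdeal A ^ k := by
    by_contra! h
    have h' : r ∈ ⨅ k, maximalIdeal A ^ k := by simpa [Submodule.mem_iInf] using h
    rw [Ideal.iInf_pow_eq_bot_of_isLocalRing _ (Ideal.IsPrime.ne_top inferInstance)] at h'
    exact hr h'
  obtain ⟨k, hk⟩ : ∃ k, Nat.find h = k + 1 := by
    refine Nat.exists_eq_succ_of_ne_zero fun h0 ↦ ?_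
    have := Nat.find_spec h
    simp [h0] at this
  have hk1 := Nat.find_spec h
  have hk0 : r ∈ maximalIdeal A ^ k := not_not.mp (Nat.find_min h (by omega))
  rw [hk] at hk1
  rw [hy, Ideal.span_singleton_pow, Ideal.mem_span_singleton] at hk0
  obtain ⟨u, hu⟩ := hk0
  refine ⟨k, u, ?_, hu⟩
  by_contra hu'
  refine hk1 ?_
  rw [hu, pow_succ]
  exact Ideal.mul_mem_mul (Ideal.pow_mem_pow (hy ▸ Ideal.mem_span_singleton_self y) k)
    ((mem_maximalIdeal u).mpr hu')

theorem IsLocalRing.isDomain_of_not_isNilpotent [IsNoetherianRing A] {y : A}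
    (hy : maximalIdeal A = Ideal.span {y}) (hn : ¬ IsNilpotent y) : IsDomain A := by
  have : NoZeroDivisors A := ⟨fun {a b} hab ↦ by
    by_contra! h
    obtain ⟨k, u, hu, rfl⟩ := exists_eq_pow_mul_unit hy h.1
    obtain ⟨l, v, hv, rfl⟩ := exists_eq_pow_mul_unit hy h.2
    refine hn ⟨k + l, (hu.mul hv).mul_left_eq_zero.mp ?_⟩
    rw [← hab]
    ring⟩
  exact NoZeroDivisors.to_isDomain A

theorem IsLocalRing.ringKrullDim_le_zero_of_isNilpotent {y : A}
    (hy : maximalIdeal A = Ideal.span {y}) (hn : IsNilpotent y) : ringKrullDim A ≤ 0 := by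
  have : Ring.KrullDimLE 0 A := Ring.KrullDimLE.mk₀ fun P hP ↦ by
    have : maximalIdeal A ≤ P := by
      rw [hy, Ideal.span_singleton_le_iff_mem]
      obtain ⟨k, hk⟩ := hn
      exact hP.mem_of_pow_mem k (hk ▸ P.zero_mem)
    rw [← (maximalIdeal.isMaximal A).eq_of_le hP.ne_top this]
    infer_instance
  exact_mod_cast (Ring.krullDimLE_iff).mp this

theorem IsLocalRing.maximalIdeal_quotient_eq_map {I : Ideal A} [IsLocalRing (A ⧸ I)] :
    maximalIdeal (A ⧸ I) = (maximalIdeal A).map (Ideal.Quotient.mk I) :=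
  (map_maximalIdeal_of_surjective _ Ideal.Quotient.mk_surjective).symm

theorem IsLocalRing.isLocalRing_quotient {I : Ideal A} (hI : I ≤ maximalIdeal A) :
    IsLocalRing (A ⧸ I) :=
  have : Nontrivial (A ⧸ I) :=
    Ideal.Quotient.nontrivial_iff.mpr (ne_top_of_le_ne_top (Ideal.IsPrime.ne_top inferInstance) hI)
  IsLocalRing.of_surjective' _ Ideal.Quotient.mk_surjective

theorem IsLocalRing.maximalIdeal_quotient_span_singleton {x y : A}
    (hm : maximalIdeal A = Ideal.span {x, y}) [IsLocalRing (A ⧸ Ideal.span {x})] :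
    maximalIdeal (A ⧸ Ideal.span {x}) = Ideal.span {Ideal.Quotient.mk (Ideal.span {x}) y} := by
  rw [maximalIdeal_quotient_eq_map, hm, Ideal.map_span, Set.image_pair,
    Ideal.Quotient.eq_zero_iff_mem.mpr (Ideal.mem_span_singleton_self x), Ideal.span_insert]
  simp

end PrincipalMaximalIdeal

/-! ### Regular pairs from dimension two, and their depth properties -/

section RegularPair

variable {A : Type*} [CommRing A] [IsLocalRing A]

theorem IsLocalRing.not_isNilpotent_mk_of_two_le_ringKrullDim [IsNoetherianRing A] {x y : A}
    (hm : maximalIdeal A = Ideal.span {x, y}) (hdim : 2 ≤ ringKrullDim A) :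
    ¬ IsNilpotent (Ideal.Quotient.mk (Ideal.span {x}) y) := by
  have hx : x ∈ maximalIdeal A := hm ▸ Ideal.subset_span (by simp)
  have := isLocalRing_quotient ((Ideal.span_singleton_le_iff_mem _).mpr hx)
  intro hn
  have h0 := ringKrullDim_le_zero_of_isNilpotent (maximalIdeal_quotient_span_singleton hm) hn
  have h1 := ringKrullDim_le_ringKrullDim_quotient_add_encard ({x} : Set A)
    (by simpa [IsLocalRing.ringJacobson_eq_maximalIdeal] using hx)
  have h2 : (2 : WithBot ℕ∞) ≤ 0 + 1 := by
    refine hdim.trans (h1.trans ?_)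
    rw [Set.encard_singleton]
    gcongr
    exact le_rfl
  norm_num at h2

theorem IsLocalRing.isPrime_span_of_two_le_ringKrullDim [IsNoetherianRing A] {x y : A}
    (hm : maximalIdeal A = Ideal.span {x, y}) (hdim : 2 ≤ ringKrullDim A) :
    (Ideal.span {x}).IsPrime := by
  have hx : x ∈ maximalIdeal A := hm ▸ Ideal.subset_span (by simp)
  have := isLocalRing_quotient ((Ideal.span_singleton_le_iff_mem _).mpr hx)
  have := isDomain_of_not_isNilpotent (maximalIdeal_quotient_span_singleton hm)
    (not_isNilpotent_mk_of_two_le_ringKrullDim hm hdim)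
  exact (Ideal.Quotient.isDomain_iff_prime _).mp this

/-- Let P be the bottom of a chain of primes of length 2, so dim A/P ≥ 2. Then x ∉ P and P ⊆ (x),
since otherwise 𝔪(A/P) would be the radical of a principal ideal. Primality gives P = xP, and
Nakayama gives P = 0. -/
theorem IsLocalRing.isDomain_of_two_le_ringKrullDim [IsNoetherianRing A] {x y : A}
    (hm : maximalIdeal A = Ideal.span {x, y}) (hdim : 2 ≤ ringKrullDim A) : IsDomain A := by
  have hx : x ∈ maximalIdeal A := hm ▸ Ideal.subset_span (by simp)
  have hprime := isPrime_span_of_two_le_ringKrullDim hm hdim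
  obtain ⟨l, hl⟩ := (Order.le_krullDim_iff (n := 2)).mp hdim
  let P := l.head.asIdeal
  have hP : P ≤ maximalIdeal A := le_maximalIdeal Ideal.IsPrime.ne_top'
  have := isLocalRing_quotient hP
  have hdimP : 2 ≤ ringKrullDim (A ⧸ P) := by
    rw [ringKrullDim_quotient]
    have : PrimeSpectrum.zeroLocus (P : Set A) = Set.Ici l.head := rfl
    rw [this, ← Order.coheight_eq_krullDim_Ici]
    have := Order.length_le_coheight_head (p := l)
    rw [hl] at this
    exact WithBot.coe_le_coe.mpr this
  have hmP : maximalIdeal (A ⧸ P) =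
      Ideal.span {Ideal.Quotient.mk P x, Ideal.Quotient.mk P y} := by
    rw [maximalIdeal_quotient_eq_map, hm, Ideal.map_span, Set.image_pair]
  have hxP : x ∉ P := by
    intro hxP
    rw [Set.pair_comm, Ideal.Quotient.eq_zero_iff_mem.mpr hxP] at hmP
    refine not_isNilpotent_mk_of_two_le_ringKrullDim hmP hdimP ?_
    simp
  have hPx : P ≤ Ideal.span {x} := by
    intro p hp
    by_contra hpx
    have := isLocalRing_quotient ((Ideal.span_singleton_le_iff_mem _).mpr hx)
    obtain ⟨k, u, hu, h⟩ := exists_eq_pow_mul_unit (maximalIdeal_quotient_span_singleton hm)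
      (r := Ideal.Quotient.mk (Ideal.span {x}) p)
      (by rwa [Ne, Ideal.Quotient.eq_zero_iff_mem])
    obtain ⟨v, hv⟩ := hu.exists_right_inv
    obtain ⟨v, rfl⟩ := Ideal.Quotient.mk_surjective v
    have h : Ideal.Quotient.mk (Ideal.span {x}) (y ^ k) =
        Ideal.Quotient.mk (Ideal.span {x}) (p * v) := by
      rw [map_mul, h, mul_assoc, hv, mul_one, map_pow]
    rw [Ideal.Quotient.eq, Ideal.mem_span_singleton] at h
    obtain ⟨c, hc⟩ := h
    -- An element of P outside (x) is y^k times a unit modulo x, which makes y nilpotent in A/(P,x).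
    refine not_isNilpotent_mk_of_two_le_ringKrullDim hmP hdimP ⟨k, ?_⟩
    rw [← map_pow, ← map_pow, Ideal.Quotient.eq_zero_iff_mem, Ideal.mem_span_singleton]
    refine ⟨Ideal.Quotient.mk P c, ?_⟩
    rw [← map_mul, Ideal.Quotient.eq, ← hc, sub_sub_cancel]
    exact P.mul_mem_right v hp
  have hP0 : P = ⊥ := by
    refine Submodule.eq_bot_of_le_smul_of_le_jacobson_bot (Ideal.span {x}) P
      P.fg_of_isNoetherianRing ?_ ?_
    · intro p hp
      obtain ⟨c, rfl⟩ := Ideal.mem_span_singleton.mp (hPx hp)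
      exact Ideal.mul_mem_mul (Ideal.mem_span_singleton_self x)
        ((l.head.isPrime.mem_or_mem hp).resolve_left hxP)
    · rw [jacobson_eq_maximalIdeal _ bot_ne_top]
      exact (Ideal.span_singleton_le_iff_mem _).mpr hx
  have : (⊥ : Ideal A).IsPrime := hP0 ▸ l.head.isPrime
  exact IsDomain.of_bot_isPrime A

theorem IsRegularLocalRing.exists_isRegularPair (A : Type*) [CommRing A] [IsRegularLocalRing A]
    (hdim : ringKrullDim A = 2) : IsDomain A ∧ ∃ x y : A, IsRegularPair x y := by
  classical
  have hs := IsRegularLocalRing.spanFinrank_maximalIdeal (R := A)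
  obtain ⟨s, hs', hspan⟩ := 
    Submodule.FG.exists_span_finset_card_eq_spanFinrank (maximalIdeal A).fg_of_isNoetherianRing
  have hcard : s.card = 2 := by
    rw [hs']
    rw [hdim] at hs
    exact_mod_cast hs
  obtain ⟨x, y, -, rfl⟩ := Finset.card_eq_two.mp hcard
  have hm : maximalIdeal A = Ideal.span {x, y} := by
    rw [← hspan]
    simp [Ideal.span]
  have := isDomain_of_two_le_ringKrullDim hm hdim.ge
  refine ⟨this, x, y, hm, fun c hc ↦ ?_, fun c hc ↦ ?_⟩
  · refine (mul_eq_zero.mp hc).resolve_left ?_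
    rintro rfl
    rw [Set.pair_comm] at hm
    refine not_isNilpotent_mk_of_two_le_ringKrullDim hm hdim.ge ?_
    simp
  · have hp := isPrime_span_of_two_le_ringKrullDim hm hdim.ge
    rw [← Ideal.mem_span_singleton] at hc ⊢
    refine (hp.mem_or_mem hc).resolve_left fun h ↦ ?_
    refine not_isNilpotent_mk_of_two_le_ringKrullDim hm hdim.ge ?_
    rw [Ideal.Quotient.eq_zero_iff_mem.mpr h]
    exact IsNilpotent.zero

-- Gives access to the stability of weakly regular sequences under flat base change.
open RingTheory.Sequence Pointwise in
theorem isRegularPair_iff_isWeaklyRegular {x y : A} : IsRegularPair x y ↔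
    maximalIdeal A = Ideal.span {x, y} ∧ IsWeaklyRegular A [x, y] := by
  have h : IsWeaklyRegular A [x, y] ↔ (∀ c, x * c = 0 → c = 0) ∧ (∀ c, x ∣ y * c → x ∣ c) := by
    rw [isWeaklyRegular_cons_iff, isWeaklyRegular_singleton_iff,
      isSMulRegular_quotient_iff_mem_of_smul_mem, isSMulRegular_iff_right_eq_zero_of_smul]
    refine and_congr Iff.rfl (forall_congr' fun c ↦ ?_)
    have hmem : ∀ r : A, r ∈ (x • ⊤ : Submodule A A) ↔ x ∣ r := fun r ↦ by
      simp [Submodule.mem_smul_pointwise_iff_exists, dvd_def, eq_comm (a := r)]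
    rw [hmem, hmem, smul_eq_mul]
  rw [h]
  exact ⟨fun h ↦ ⟨h.1, h.2, h.3⟩, fun h ↦ ⟨h.1, h.2.1, h.2.2⟩⟩

theorem IsRegularPair.map {x y : A} (h : IsRegularPair x y) (B : Type*) [CommRing B]
    [IsLocalRing B] [Algebra A B] [Module.Flat A B]
    (hB : (maximalIdeal A).map (algebraMap A B) = maximalIdeal B) :
    IsRegularPair (algebraMap A B x) (algebraMap A B y) := by
  rw [isRegularPair_iff_isWeaklyRegular] at h ⊢
  refine ⟨?_, by simpa using h.2.of_flat (S := B)⟩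
  rw [← hB, h.1, Ideal.map_span, Set.image_pair]

/-- Depth two: for regular b, no nonzero element of A/b is killed by a power of 𝔪. From rxc = bd and
ryc = be follows yd = xe, so x divides d and can be cancelled. -/
theorem IsRegularPair.dvd_of_forall_mem {x y : A} (h : IsRegularPair x y) {b : A}
    (hb : ∀ c, b * c = 0 → c = 0) (n : ℕ) (c : A)
    (hc : ∀ r ∈ maximalIdeal A ^ n, b ∣ r * c) : b ∣ c := by
  have hx : x ∈ maximalIdeal A := h.maximalIdeal_eq ▸ Ideal.subset_span (by simp)
  have hy : y ∈ maximalIdeal A := h.maximalIdeal_eq ▸ Ideal.subset_span (by simp)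
  induction n generalizing c with
  | zero => simpa using hc 1 (by simp)
  | succ n ih =>
    refine ih c fun r hr ↦ ?_
    obtain ⟨d, hd⟩ := hc (r * x) (pow_succ (maximalIdeal A) n ▸ Ideal.mul_mem_mul hr hx)
    obtain ⟨e, he⟩ := hc (r * y) (pow_succ (maximalIdeal A) n ▸ Ideal.mul_mem_mul hr hy)
    have h1 : y * d - x * e = 0 := hb _ (by linear_combination x * he - y * hd)
    obtain ⟨f, rfl⟩ := h.right d ⟨e, by linear_combination h1⟩
    exact ⟨f, sub_eq_zero.mp (h.left _ (by linear_combination hd))⟩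

theorem IsRegularPair.not_pow_le_span_singleton {x y : A} (h : IsRegularPair x y) {b : A}
    (hb : b ∈ maximalIdeal A) (n : ℕ) : ¬ maximalIdeal A ^ n ≤ Ideal.span {b} := by
  intro hn
  have hx : x ∈ maximalIdeal A := h.maximalIdeal_eq ▸ Ideal.subset_span (by simp)
  have hreg : ∀ c, b * c = 0 → c = 0 := by
    intro c hc
    obtain ⟨d, hd⟩ := Ideal.mem_span_singleton.mp (hn (Ideal.pow_mem_pow hx n))
    have : ∀ k, x ^ k * c = 0 → c = 0 := by
      intro k
      induction k with
      | zero => simp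
      | succ k ih => exact fun hk ↦ ih (h.left _ (by rw [← hk]; ring))
    refine this n ?_
    rw [hd]
    linear_combination d * hc
  have h1 : b ∣ 1 := h.dvd_of_forall_mem hreg n 1 fun r hr ↦ by
    simpa using Ideal.mem_span_singleton.mp (hn hr)
  exact (mem_maximalIdeal b).mp hb (isUnit_of_dvd_one h1)

theorem IsRegularPair.pow_succ_ne {x y : A} (h : IsRegularPair x y) [IsNoetherianRing A] (n : ℕ) :
    ¬ maximalIdeal A ^ n ≤ maximalIdeal A ^ (n + 1) := by
  intro hle
  have h0 : maximalIdeal A ^ n ≤ ⊥ :=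
    Submodule.le_of_le_smul_of_le_jacobson_bot (I := maximalIdeal A)
      (Ideal.fg_of_isNoetherianRing _)
      (jacobson_eq_maximalIdeal _ bot_ne_top).ge
      (by rw [bot_sup_eq, smul_eq_mul, ← pow_succ']; exact hle)
  exact h.not_pow_le_span_singleton (b := 0) (zero_mem _) n (h0.trans bot_le)

end RegularPair

/-! ### Full ideals: the multiplicity bound and the lower bound for μ -/

section FullIdeal

variable {R : Type*} [CommRing R] [IsLocalRing R]

theorem IsRegularPair.left_mem {x y : R} (h : IsRegularPair x y) : x ∈ maximalIdeal R :=
  h.maximalIdeal_eq ▸ Ideal.subset_span (by simp)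

theorem IsRegularPair.right_mem {x y : R} (h : IsRegularPair x y) : y ∈ maximalIdeal R :=
  h.maximalIdeal_eq ▸ Ideal.subset_span (by simp)

theorem IsRegularPair.left_notMem_sq {x y : R} (h : IsRegularPair x y) :
    x ∉ maximalIdeal R ^ 2 := by
  intro hx
  refine h.not_pow_le_span_singleton h.right_mem 1 ?_
  rw [pow_one]
  refine Submodule.le_of_le_smul_of_le_jacobson_bot (I := maximalIdeal R)
    (h.maximalIdeal_eq ▸ Submodule.fg_span (Set.toFinite _))
    (jacobson_eq_maximalIdeal _ bot_ne_top).ge ?_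
  refine h.maximalIdeal_eq.le.trans (Ideal.span_le.mpr ?_)
  rintro _ (rfl | rfl)
  · exact Ideal.mem_sup_right (by rwa [smul_eq_mul, ← sq])
  · exact Ideal.mem_sup_left (Ideal.mem_span_singleton_self _)

/-- If z ∈ 𝔪², then K𝔪² ⊆ J implies Kz ⊆ J, hence K𝔪 ⊆ J. Descending from 𝔪^(n+1) ⊆ J gives 𝔪 ⊆ J,
and then every element of 𝔪 is full. -/
theorem IsRegularPair.exists_fullElement_notMem_sq {x y : R} (h : IsRegularPair x y)
    {J : Ideal R} {n : ℕ} (hn : maximalIdeal R ^ n ≤ J) (hfull : HasFullElement J) :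
    ∃ z ∈ maximalIdeal R, z ∉ maximalIdeal R ^ 2 ∧
      J.colon {z} = J.colon (maximalIdeal R : Set R) := by
  obtain ⟨z, hz, hcolon⟩ := hfull
  by_cases hz2 : z ∈ maximalIdeal R ^ 2
  · have hstep : ∀ K : Ideal R, K * maximalIdeal R ^ 2 ≤ J → K * maximalIdeal R ≤ J := by
      intro K hK
      rw [Ideal.mul_le]
      intro r hr s hs
      have : r ∈ J.colon (maximalIdeal R : Set R) :=
        hcolon ▸ Submodule.mem_colon_singleton.mpr (hK (Ideal.mul_mem_mul hr hz2))
      exact Submodule.mem_colon.mp this s hs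
    have hpow : ∀ k, ∀ K : Ideal R, K * maximalIdeal R ^ (k + 1) ≤ J → K * maximalIdeal R ≤ J := by
      intro k
      induction k with
      | zero => simp
      | succ k ih =>
        refine fun K hK ↦ ih K ?_
        rw [pow_succ, ← mul_assoc]
        refine hstep _ ?_
        rw [mul_assoc, ← pow_add]
        exact hK
    have hmJ : maximalIdeal R ≤ J := by
      simpa using hpow n ⊤ (by
        rw [Ideal.top_mul]
        exact (Ideal.pow_le_pow_right n.le_succ).trans hn)
    have htop : ∀ s : Set R, s ⊆ maximalIdeal R → J.colon s = ⊤ := fun s hs ↦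
      Submodule.eq_top_iff'.mpr fun r ↦ Submodule.mem_colon.mpr fun t ht ↦
        J.mul_mem_left _ (hmJ (hs ht))
    refine ⟨x, h.left_mem, h.left_notMem_sq, ?_⟩
    rw [htop _ le_rfl, htop _ (by simpa using h.left_mem)]
  · exact ⟨z, hz, hz2, hcolon⟩

theorem IsLocalRing.exists_maximalIdeal_eq_span_pair {x y : R}
    (hm : maximalIdeal R = Ideal.span {x, y}) {z : R} (hz : z ∈ maximalIdeal R)
    (hz2 : z ∉ maximalIdeal R ^ 2) : ∃ w, maximalIdeal R = Ideal.span {z, w} := by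
  have hx : x ∈ maximalIdeal R := hm ▸ Ideal.subset_span (by simp)
  have hy : y ∈ maximalIdeal R := hm ▸ Ideal.subset_span (by simp)
  obtain ⟨a, b, hab⟩ := Ideal.mem_span_pair.mp (hm ▸ hz)
  have key : ∀ {x' y' a b : R}, x' ∈ maximalIdeal R → y' ∈ maximalIdeal R →
      maximalIdeal R = Ideal.span {x', y'} → a * x' + b * y' = z →
      IsUnit a → ∃ w, maximalIdeal R = Ideal.span {z, w} := by
    intro x' y' a b hx hy hm hab ha
    obtain ⟨c, hc⟩ := ha.exists_left_inv
    refine ⟨y', le_antisymm ?_ ?_⟩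
    · refine hm.le.trans (Ideal.span_le.mpr ?_)
      rintro _ (h | h) <;> rw [h]
      · exact Ideal.mem_span_pair.mpr ⟨c, -(c * b), by linear_combination (-c) * hab + x' * hc⟩
      · exact Ideal.subset_span (by simp)
    · rw [Ideal.span_le]
      rintro _ (rfl | rfl)
      exacts [hz, hy]
  by_cases ha : IsUnit a
  · exact key hx hy hm hab ha
  by_cases hb : IsUnit b
  · exact key hy hx (by rwa [Set.pair_comm]) (by rwa [add_comm]) hb
  refine (hz2 ?_).elim
  rw [← hab, sq]
  exact add_mem (Ideal.mul_mem_mul ((mem_maximalIdeal a).mpr ha) hx)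
    (Ideal.mul_mem_mul ((mem_maximalIdeal b).mpr hb) hy)

/-- The image of J in R/z is generated by the least power of w it contains; lift that power to a ∈
J. -/
theorem IsLocalRing.exists_sup_span_singleton_eq [IsNoetherianRing R] {z w : R}
    (hm : maximalIdeal R = Ideal.span {z, w}) {J : Ideal R} {n : ℕ} (hn : maximalIdeal R ^ n ≤ J) :
    ∃ a ∈ J, Ideal.span {a, z} = J ⊔ Ideal.span {z} := by
  classical
  have hz : z ∈ maximalIdeal R := hm ▸ Ideal.subset_span (by simp)
  have hw : w ∈ maximalIdeal R := hm ▸ Ideal.subset_span (by simp)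
  have hex : ∃ t, w ^ t ∈ J ⊔ Ideal.span {z} :=
    ⟨n, Ideal.mem_sup_left (hn (Ideal.pow_mem_pow hw n))⟩
  obtain ⟨a, ha, b, hb, hab⟩ := Submodule.mem_sup.mp (Nat.find_spec hex)
  obtain ⟨c, rfl⟩ := Ideal.mem_span_singleton'.mp hb
  refine ⟨a, ha, le_antisymm ?_ ?_⟩
  · rw [Ideal.span_insert]
    exact sup_le_sup_right ((Ideal.span_singleton_le_iff_mem _).mpr ha) _
  · intro e he
    have := isLocalRing_quotient ((Ideal.span_singleton_le_iff_mem _).mpr hz)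
    by_cases hez : Ideal.Quotient.mk (Ideal.span {z}) e = 0
    · rw [Ideal.Quotient.eq_zero_iff_mem] at hez
      exact Ideal.span_mono (by simp) hez
    obtain ⟨k, u, hu, h⟩ :=
      exists_eq_pow_mul_unit (maximalIdeal_quotient_span_singleton hm) hez
    obtain ⟨v, hv⟩ := hu.exists_right_inv
    obtain ⟨u, rfl⟩ := Ideal.Quotient.mk_surjective u
    obtain ⟨v, rfl⟩ := Ideal.Quotient.mk_surjective v
    have h1 : w ^ k - e * v ∈ Ideal.span {z} := by
      rw [← Ideal.Quotient.eq, map_mul, h, mul_assoc, hv, mul_one, map_pow]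
    have h2 : Nat.find hex ≤ k := by
      refine Nat.find_min' hex ?_
      rw [← sub_add_cancel (w ^ k) (e * v)]
      exact add_mem (Ideal.mem_sup_right h1) (Ideal.mul_mem_right _ _ he)
    have h3 : e - w ^ k * u ∈ Ideal.span {z} := by
      rw [← Ideal.Quotient.eq, h, map_mul, map_pow]
    obtain ⟨d, hd⟩ := Ideal.mem_span_singleton'.mp h3
    obtain ⟨l, rfl⟩ := Nat.exists_eq_add_of_le h2
    refine Ideal.mem_span_pair.mpr ⟨w ^ l * u, c * w ^ l * u + d, ?_⟩
    rw [pow_add] at hd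
    linear_combination hd + w ^ l * u * hab

theorem IsLocalRing.colength_pow_mul_two_le {J : Ideal R} {n : ℕ} (hn : maximalIdeal R ^ n ≤ J)
    {a z : R} (ha : a ∈ J) (hz : z ∈ maximalIdeal R) (k : ℕ) :
    (J ^ k).colength * 2 ≤ n * (Ideal.span {a, z}).colength * (k * (k + 1)) := by
  induction k with
  | zero => simp [Ideal.colength_top]
  | succ k ih =>
    have h1 : (J ^ (k + 1)).colength ≤
        (J ^ k).colength + (n * (k + 1) : ℕ) * (Ideal.span {a, z}).colength := by
      refine (Ideal.colength_le_add_of_colon_le a (K := J ^ k)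
        (L := Ideal.span {a, z ^ (n * (k + 1))}) ?_ ?_).trans ?_
      · exact fun r hr ↦ pow_succ J k ▸ Ideal.mul_mem_mul hr ha
      · rw [Ideal.span_insert, sup_comm]
        refine sup_le_sup_right ((Ideal.span_singleton_le_iff_mem _).mpr ?_) _
        rw [pow_mul]
        exact Ideal.pow_mem_pow (hn (Ideal.pow_mem_pow hz n)) _
      · gcongr
        exact Ideal.colength_span_pair_pow_le _ _ _
    calc (J ^ (k + 1)).colength * 2
        ≤ ((J ^ k).colength + (n * (k + 1) : ℕ) * (Ideal.span {a, z}).colength) * 2 := by gcongr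
      _ = (J ^ k).colength * 2 + (n * (k + 1) : ℕ) * (Ideal.span {a, z}).colength * 2 := by ring
      _ ≤ n * (Ideal.span {a, z}).colength * (k * (k + 1)) +
          (n * (k + 1) : ℕ) * (Ideal.span {a, z}).colength * 2 := by gcongr
      _ = _ := by push_cast; ring

/-- The ideals 𝔪^s + (z) strictly decrease with s: an equality would give 𝔪^s ⊆ (z) by Nakayama. -/
theorem IsRegularPair.le_colength_of_le_pow [IsNoetherianRing R] {x y : R} (h : IsRegularPair x y)
    {J : Ideal R} {z : R} (hz : z ∈ maximalIdeal R) {s : ℕ} (hs : J ≤ maximalIdeal R ^ s) :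
    (s : ℕ∞) ≤ (J ⊔ Ideal.span {z}).colength := by
  refine le_trans ?_ (Ideal.colength_anti (sup_le_sup_right hs _))
  clear hs
  induction s with
  | zero => simp
  | succ s ih =>
    push_cast
    refine (add_le_add_left ih 1).trans ?_
    rw [Ideal.colength, Ideal.colength, Module.length_quotient, Module.length_quotient]
    refine Order.coheight_add_one_le (lt_of_le_of_ne
      (sup_le_sup_right (Ideal.pow_le_pow_right s.le_succ) _) fun heq ↦ ?_)
    refine h.not_pow_le_span_singleton hz s ?_
    refine Submodule.le_of_le_smul_of_le_jacobson_bot (I := maximalIdeal R)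
      (Ideal.fg_of_isNoetherianRing _) (jacobson_eq_maximalIdeal _ bot_ne_top).ge ?_
    rw [smul_eq_mul, ← pow_succ', sup_comm, heq]
    exact le_sup_left

/-- The multiplicity bound and the order bound for an ideal with a full element. -/
theorem IsRegularPair.bounds_of_hasFullElement [IsNoetherianRing R] {x y : R}
    (h : IsRegularPair x y) {J : Ideal R} {n : ℕ} (hn : maximalIdeal R ^ n ≤ J)
    (hfull : HasFullElement J) :
    (∀ s, J ≤ maximalIdeal R ^ s → s + 1 ≤ J.spanFinrank) ∧
    ∀ k : ℕ, (J ^ k).colength * 2 + n * (k * (k + 1) : ℕ) ≤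
      n * J.spanFinrank * (k * (k + 1) : ℕ) := by
  obtain ⟨z, hz, hz2, hcolon⟩ := h.exists_fullElement_notMem_sq hn hfull
  have hμ := h.spanFinrank_eq J.fg_of_isNoetherianRing hn hcolon
  refine ⟨fun s hs ↦ ?_, fun k ↦ ?_⟩
  · have := h.le_colength_of_le_pow hz hs
    have : (s : ℕ∞) + 1 ≤ J.spanFinrank := hμ ▸ add_le_add_left this 1
    exact_mod_cast this
  · obtain ⟨w, hw⟩ := exists_maximalIdeal_eq_span_pair h.maximalIdeal_eq hz hz2
    obtain ⟨a, ha, haz⟩ := exists_sup_span_singleton_eq hw hn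
    have := colength_pow_mul_two_le hn ha hz k
    rw [hμ, ← haz]
    push_cast
    calc _ ≤ _ := add_le_add_left this _
      _ = _ := by ring

end FullIdeal

/-! ### Infinite residue field: the upper bound for μ -/

section InfiniteResidueField

theorem Field.exists_sum_mul_pow_ne_zero {k : Type*} [Field k] [Infinite k] (s : Finset ℕ)
    (f : ℕ → k) {i : ℕ} (hi : i ∈ s) (hf : f i ≠ 0) : ∃ u, ∑ j ∈ s, f j * u ^ j ≠ 0 := by
  by_contra! h
  have hP : (∑ j ∈ s, Polynomial.monomial j (f j)) = 0 := by
    refine Polynomial.funext fun u ↦ ?_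
    simpa [Polynomial.eval_finsetSum] using h u
  apply hf
  have := congrArg (Polynomial.coeff · i) hP
  simpa [Polynomial.finsetSum_coeff, Polynomial.coeff_monomial, hi] using this

theorem Ideal.exists_sum_of_mem_span_pair_pow {R : Type*} [CommRing R] {x y : R} (s : ℕ) {a : R}
    (ha : a ∈ Ideal.span {x, y} ^ s) :
    ∃ c : ℕ → R, a = ∑ i ∈ Finset.range (s + 1), c i * (x ^ i * y ^ (s - i)) := by
  classical
  have hle : Ideal.span {x, y} ^ s ≤
      Ideal.span ((fun i ↦ x ^ i * y ^ (s - i)) '' (Finset.range (s + 1) : Set ℕ)) := by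
    clear ha
    induction s with
    | zero => simp
    | succ s ih =>
      rw [pow_succ]
      refine (Ideal.mul_mono_left ih).trans ?_
      rw [Ideal.span_mul_span', Ideal.span_le]
      rintro _ ⟨_, ⟨i, hi, rfl⟩, _, rfl | rfl, rfl⟩
      · refine Ideal.subset_span ⟨i + 1, by simpa using hi, ?_⟩
        simp only [Nat.add_sub_add_right]
        ring
      · refine Ideal.subset_span ⟨i, by simp at hi ⊢; omega, ?_⟩
        have : i ≤ s := by simpa [Nat.lt_succ_iff] using hi
        simp only [Nat.succ_sub this]
        rw [pow_succ]
        ring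
  obtain ⟨c, hc⟩ := (Submodule.mem_span_image_finset_iff_exists_fun' R).mp (hle ha)
  exact ⟨c, hc.symm⟩

variable {R : Type*} [CommRing R] [IsLocalRing R]

/-- Take a ∈ J of order exactly s = ord J. Its leading form is nonzero at (u, 1) for some u, so a is
a unit times y^s modulo z = x - uy. Thus y^s ∈ (J,z), and ℓ(R/(J,z)) ≤ s. -/
theorem IsRegularPair.exists_spanFinrank_le [IsNoetherianRing R] [Infinite (ResidueField R)]
    {x y : R} (h : IsRegularPair x y) {J : Ideal R} {n : ℕ} (hn : maximalIdeal R ^ n ≤ J) :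
    ∃ s, J ≤ maximalIdeal R ^ s ∧ J.spanFinrank ≤ s + 1 := by
  classical
  have hex : ∃ s, ¬ J ≤ maximalIdeal R ^ s := ⟨n + 1, fun hle ↦ h.pow_succ_ne n (hn.trans hle)⟩
  obtain ⟨s, hs⟩ : ∃ s, Nat.find hex = s + 1 := by
    refine Nat.exists_eq_succ_of_ne_zero fun h0 ↦ ?_
    have := Nat.find_spec hex
    simp [h0] at this
  have hs1 := Nat.find_spec hex
  have hs0 : J ≤ maximalIdeal R ^ s := not_not.mp (Nat.find_min hex (by omega))
  rw [hs, SetLike.not_le_iff_exists] at hs1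
  obtain ⟨a, haJ, ha⟩ := hs1
  obtain ⟨c, hc⟩ := Ideal.exists_sum_of_mem_span_pair_pow s
    (by rw [← h.maximalIdeal_eq]; exact hs0 haJ : a ∈ Ideal.span {x, y} ^ s)
  have hmem : ∀ i ∈ Finset.range (s + 1), x ^ i * y ^ (s - i) ∈ maximalIdeal R ^ s := by
    intro i hi
    have := Ideal.mul_mem_mul (Ideal.pow_mem_pow h.left_mem i)
      (Ideal.pow_mem_pow h.right_mem (s - i))
    rwa [← pow_add, Nat.add_sub_cancel' (by simpa [Nat.lt_succ_iff] using hi)] at this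
  obtain ⟨i, hi, hci⟩ : ∃ i ∈ Finset.range (s + 1), residue R (c i) ≠ 0 := by
    by_contra! hall
    refine ha ?_
    rw [hc, pow_succ']
    exact sum_mem fun i hi ↦ Ideal.mul_mem_mul ((residue_eq_zero_iff _).mp (hall i hi)) (hmem i hi)
  obtain ⟨u, hu⟩ := Field.exists_sum_mul_pow_ne_zero _ (fun i ↦ residue R (c i)) hi hci
  obtain ⟨u, rfl⟩ := residue_surjective u
  have hunit : IsUnit (∑ i ∈ Finset.range (s + 1), c i * u ^ i) := by
    by_contra hnu
    refine hu ?_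
    simpa using (residue_eq_zero_iff _).mpr ((mem_maximalIdeal _).mpr hnu)
  refine ⟨s, hs0, ?_⟩
  have hz : x - u * y ∈ maximalIdeal R :=
    sub_mem h.left_mem (Ideal.mul_mem_left _ _ h.right_mem)
  have h1 := h.spanFinrank_le J.fg_of_isNoetherianRing hn hz
  have h2 : Ideal.span {x - u * y, y ^ s} ≤ J ⊔ Ideal.span {x - u * y} := by
    rw [Ideal.span_insert, sup_comm]
    refine sup_le ((Ideal.span_singleton_le_iff_mem _).mpr ?_) le_sup_right
    have h3 : a - (∑ i ∈ Finset.range (s + 1), c i * u ^ i) * y ^ s ∈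
        Ideal.span {x - u * y} := by
      rw [hc, Finset.sum_mul, ← Finset.sum_sub_distrib]
      refine sum_mem fun i hi ↦ Ideal.mem_span_singleton.mpr ?_
      have h4 : y ^ s = y ^ i * y ^ (s - i) := by
        rw [← pow_add, Nat.add_sub_cancel' (by simpa [Nat.lt_succ_iff] using hi)]
      have h5 : c i * (x ^ i * y ^ (s - i)) - c i * u ^ i * y ^ s =
          c i * y ^ (s - i) * (x ^ i - (u * y) ^ i) := by
        rw [h4, mul_pow]
        ring
      rw [h5]
      exact (sub_dvd_pow_sub_pow _ _ _).mul_left _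
    obtain ⟨v, hv⟩ := hunit.exists_left_inv
    have h6 : y ^ s = v * (a - (a - (∑ i ∈ Finset.range (s + 1), c i * u ^ i) * y ^ s)) := by
      linear_combination (-y ^ s) * hv
    rw [h6]
    exact Ideal.mul_mem_left _ _ (sub_mem (Ideal.mem_sup_left haJ) (Ideal.mem_sup_right h3))
  have h7 : Ideal.span {x - u * y, y} = maximalIdeal R := by
    rw [h.maximalIdeal_eq]
    refine le_antisymm (Ideal.span_le.mpr ?_) (Ideal.span_le.mpr ?_)
    · rintro _ (rfl | rfl)
      · exact Ideal.mem_span_pair.mpr ⟨1, -u, by ring⟩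
      · exact Ideal.subset_span (by simp)
    · rintro _ (rfl | rfl)
      · exact Ideal.mem_span_pair.mpr ⟨1, u, by ring⟩
      · exact Ideal.subset_span (by simp)
  have h8 := (Ideal.colength_anti h2).trans (Ideal.colength_span_pair_pow_le _ _ _)
  rw [h7, colength_maximalIdeal, mul_one] at h8
  have h9 : (J.spanFinrank : ℕ∞) ≤ s + 1 := h1.trans (add_le_add_left h8 1)
  exact_mod_cast h9

end InfiniteResidueField

/-! ### Flat local base change with 𝔪B maximal -/

section BaseChange

variable {A B : Type*} [CommRing A] [CommRing B] [IsLocalRing A] [IsLocalRing B] [Algebra A B]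

theorem IsLocalRing.isLocalHom_of_map_eq
    (hB : (maximalIdeal A).map (algebraMap A B) = maximalIdeal B) :
    IsLocalHom (algebraMap A B) :=
  ((IsLocalRing.local_hom_TFAE (algebraMap A B)).out 0 2).mpr hB.le

theorem IsLocalRing.maximalIdeal_pow_le_map
    (hB : (maximalIdeal A).map (algebraMap A B) = maximalIdeal B) {J : Ideal A} {n : ℕ}
    (hn : maximalIdeal A ^ n ≤ J) : maximalIdeal B ^ n ≤ J.map (algebraMap A B) := by
  rw [← hB, ← Ideal.map_pow]
  exact Ideal.map_mono hn

variable [Module.Flat A B]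

theorem IsLocalRing.colength_map (hB : (maximalIdeal A).map (algebraMap A B) = maximalIdeal B)
    (J : Ideal A) : (J.map (algebraMap A B)).colength = J.colength := by
  have := isLocalHom_of_map_eq hB
  have h := IsLocalRing.length_baseChange A B (A ⧸ J)
  rw [hB] at h
  change _ = J.colength * (maximalIdeal B).colength at h
  rw [colength_maximalIdeal, mul_one] at h
  rw [← h]
  exact (Algebra.TensorProduct.quotIdealMapEquivTensorQuot B J).toLinearEquiv.length_eq

/-- μ(J) is the difference of the colengths of 𝔪J and J, and both are preserved. -/
theorem IsLocalRing.spanFinrank_map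
    (hB : (maximalIdeal A).map (algebraMap A B) = maximalIdeal B)
    {J : Ideal A} (hJ : J.FG) (hfin : J.colength ≠ ⊤) :
    (J.map (algebraMap A B)).spanFinrank = J.spanFinrank := by
  have h1 := colength_maximalIdeal_mul (hJ.map (algebraMap A B))
  rw [← hB, ← Ideal.map_mul, colength_map hB, colength_map hB, colength_maximalIdeal_mul hJ] at h1
  have h2 := ENat.add_left_injective_of_ne_top hfin h1
  exact_mod_cast h2.symm

theorem IsLocalRing.map_le_maximalIdeal_pow_iff
    (hB : (maximalIdeal A).map (algebraMap A B) = maximalIdeal B) (J : Ideal A) (s : ℕ) :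
    J.map (algebraMap A B) ≤ maximalIdeal B ^ s ↔ J ≤ maximalIdeal A ^ s := by
  have := isLocalHom_of_map_eq hB
  have : Module.FaithfullyFlat A B := Module.FaithfullyFlat.of_flat_of_isLocalHom
  rw [← hB, ← Ideal.map_pow, Ideal.map_le_iff_le_comap, Ideal.comap_map_eq_self_of_faithfullyFlat]

end BaseChange

open Polynomial in
/-- A flat local extension with infinite residue field, namely the localization of `A[X]` at
`𝔪A[X]`. -/
theorem IsLocalRing.exists_flat_infinite_residueField (A : Type u) [CommRing A] [IsLocalRing A]
    [IsNoetherianRing A] [IsDomain A] :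
    ∃ (B : Type u) (_ : CommRing B) (_ : IsLocalRing B) (_ : IsNoetherianRing B) (_ : Algebra A B),
      IsDomain B ∧ Module.Flat A B ∧ Infinite (ResidueField B) ∧
      (maximalIdeal A).map (algebraMap A B) = maximalIdeal B := by
  let P : Ideal A[X] := (maximalIdeal A).map C
  have hP : P.IsPrime := Ideal.isPrime_map_C_of_isPrime
  refine ⟨Localization.AtPrime P, inferInstance, inferInstance,
    IsLocalization.isNoetherianRing P.primeCompl _ inferInstance, inferInstance,
    IsLocalization.isDomain_localization P.primeCompl_le_nonZeroDivisors, ?_, ?_, ?_⟩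
  · have : Module.Flat A[X] (Localization.AtPrime P) := IsLocalization.flat _ P.primeCompl
    exact Module.Flat.trans A A[X] (Localization.AtPrime P)
  -- The powers of X have distinct residues, since the coefficient 1 of X^i in X^i - X^j is not in
  -- 𝔪.
  · refine Infinite.of_injective
      (fun i : ℕ ↦ residue _ (algebraMap A[X] (Localization.AtPrime P) (X ^ i))) fun i j hij ↦ ?_
    by_contra hne
    have h1 : X ^ i - X ^ j ∈ P := by
      rw [← IsLocalization.AtPrime.to_map_mem_maximal_iff (Localization.AtPrime P) P,
        ← residue_eq_zero_iff, map_sub, map_sub]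
      exact sub_eq_zero.mpr hij
    have h2 := (Ideal.mem_map_C_iff.mp h1) i
    rw [coeff_sub, coeff_X_pow_self, coeff_X_pow, if_neg hne, sub_zero] at h2
    exact (Ideal.ne_top_iff_one _).mp (Ideal.IsPrime.ne_top inferInstance) h2
  · rw [IsScalarTower.algebraMap_eq A A[X] (Localization.AtPrime P), ← Ideal.map_map]
    exact Localization.AtPrime.map_eq_maximalIdeal

/-! ### Powers of an ideal modulo I·J^n -/

section PowLemmas

variable {R : Type*} [CommRing R]

theorem Ideal.sup_span_singleton_pow_succ_le (I : Ideal R) (c : R) (n : ℕ) :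
    (I ⊔ Ideal.span {c}) ^ (n + 1) ≤
      I * (I ⊔ Ideal.span {c}) ^ n ⊔ Ideal.span {c ^ (n + 1)} := by
  induction n with
  | zero => simp
  | succ n ih =>
    set J := I ⊔ Ideal.span {c} with hJ
    have hc : Ideal.span {c} ≤ J := le_sup_right
    calc J ^ (n + 1 + 1) = I * J ^ (n + 1) ⊔ Ideal.span {c} * J ^ (n + 1) := by
          rw [pow_succ' J (n + 1), ← Ideal.sup_mul, ← hJ]
      _ ≤ I * J ^ (n + 1) ⊔ Ideal.span {c} * (I * J ^ n ⊔ Ideal.span {c ^ (n + 1)}) := by gcongr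
      _ ≤ _ := by
          rw [Ideal.mul_sup, ← sup_assoc, Ideal.span_singleton_mul_span_singleton, ← pow_succ']
          refine sup_le_sup_right (sup_le le_rfl ?_) _
          rw [mul_left_comm, pow_succ' J n]
          exact Ideal.mul_mono_right (Ideal.mul_mono_left hc)

theorem Ideal.pow_sub_pow_mem_mul_pow {I J : Ideal R} {a b : R} (ha : a ∈ J) (hb : b ∈ J)
    (hab : a - b ∈ I) (n : ℕ) : a ^ (n + 1) - b ^ (n + 1) ∈ I * J ^ n := by
  induction n with
  | zero => simpa using hab
  | succ n ih =>
    have h : a ^ (n + 1 + 1) - b ^ (n + 1 + 1) =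
        a * (a ^ (n + 1) - b ^ (n + 1)) + (a - b) * b ^ (n + 1) := by ring
    rw [h]
    refine add_mem ?_ (Ideal.mul_mem_mul hab (Ideal.pow_mem_pow hb _))
    rw [pow_succ' J, mul_left_comm]
    exact Ideal.mul_mem_mul ha ih

theorem Ideal.pow_sub_pow_mul_mem_mul_pow {I J : Ideal R} {a b w : R} (ha : a ∈ J) (hb : b ∈ J)
    (hab : a - b ∈ I) {i l n : ℕ} (hw : w ∈ J ^ l) (hn : i + l = n + 1) :
    (a ^ i - b ^ i) * w ∈ I * J ^ n := by
  cases i with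
  | zero => simp
  | succ i =>
    obtain rfl : n = i + l := by omega
    rw [pow_add, ← mul_assoc]
    exact Ideal.mul_mem_mul (Ideal.pow_sub_pow_mem_mul_pow ha hb hab i) hw

/-- Substituting a ≡ uc and b ≡ vc in a monomial of degree n+1 costs a factor in I, with n factors
left in J. -/
theorem Ideal.monomial_sub_mem_mul_pow {I J : Ideal R} {a b c u v : R} (ha : a ∈ J) (hb : b ∈ J)
    (hc : c ∈ J) (hau : a - u * c ∈ I) (hbv : b - v * c ∈ I) {i j k n : ℕ}
    (hn : i + j + k = n + 1) :
    a ^ i * b ^ j * c ^ k - u ^ i * v ^ j * c ^ (n + 1) ∈ I * J ^ n := by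
  have h : a ^ i * b ^ j * c ^ k - u ^ i * v ^ j * c ^ (n + 1) =
      (a ^ i - (u * c) ^ i) * (b ^ j * c ^ k) +
        (b ^ j - (v * c) ^ j) * ((u * c) ^ i * c ^ k) := by
    rw [← hn, pow_add, pow_add]
    ring
  rw [h]
  refine add_mem
    (Ideal.pow_sub_pow_mul_mem_mul_pow ha (J.mul_mem_left _ hc) hau (l := j + k) ?_ (by omega))
    (Ideal.pow_sub_pow_mul_mem_mul_pow hb (J.mul_mem_left _ hc) hbv (l := i + k) ?_ (by omega))
  · rw [pow_add]
    exact Ideal.mul_mem_mul (Ideal.pow_mem_pow hb _) (Ideal.pow_mem_pow hc _)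
  · rw [pow_add]
    exact Ideal.mul_mem_mul (Ideal.pow_mem_pow (J.mul_mem_left _ hc) _) (Ideal.pow_mem_pow hc _)

end PowLemmas

/-! ### Two-generated reductions -/

section Reduction

variable {R : Type*} [CommRing R] [IsLocalRing R]

theorem IsLocalRing.exists_sum_mem_maximalIdeal_mul {J : Ideal R} (hJ : J.FG) {ι : Type*}
    (s : Finset ι) (w : ι → R) (hw : ∀ i ∈ s, w i ∈ J) (hs : J.spanFinrank < s.card) :
    ∃ G : ι → R, (∃ i ∈ s, residue R (G i) ≠ 0) ∧ ∑ i ∈ s, G i * w i ∈ maximalIdeal R * J := by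
  classical
  have : Module.Finite R J := Module.Finite.iff_fg.mpr hJ
  let _ : Field (R ⧸ maximalIdeal R) := Ideal.Quotient.field _
  let V := J ⧸ maximalIdeal R • (⊤ : Submodule R J)
  have : Module.Finite (R ⧸ maximalIdeal R) V :=
    Module.Finite.of_restrictScalars_finite R _ _
  let vec : s → V := fun i ↦ Submodule.Quotient.mk ⟨w i, hw i i.2⟩
  have hdep : ¬ LinearIndependent (R ⧸ maximalIdeal R) vec := by
    intro hli
    have h1 := hli.fintype_card_le_finrank
    rw [← spanFinrank_eq_finrank_quotient J hJ, Fintype.card_coe] at h1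
    omega
  rw [Fintype.not_linearIndependent_iff] at hdep
  obtain ⟨g, hg, i, hi⟩ := hdep
  choose G hG using fun i ↦ Ideal.Quotient.mk_surjective (I := maximalIdeal R) (g i)
  refine ⟨fun i ↦ if h : i ∈ s then G ⟨i, h⟩ else 0, ⟨i, i.2, ?_⟩, ?_⟩
  · simp only [i.2, dite_true]
    change Ideal.Quotient.mk (maximalIdeal R) (G i) ≠ 0
    rwa [hG]
  · have h1 : (Submodule.Quotient.mk (∑ i : s, G i • (⟨w i, hw i i.2⟩ : J)) : V) = 0 := by
      rw [← hg, ← Submodule.mkQ_apply, map_sum]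
      refine Finset.sum_congr rfl fun i _ ↦ ?_
      rw [← hG]
      rfl
    rw [Submodule.Quotient.mk_eq_zero] at h1
    have h2 := Submodule.mem_map_of_mem (f := J.subtype) h1
    rw [Submodule.map_smul'', Submodule.map_top, Submodule.range_subtype, map_sum] at h2
    rw [← Finset.sum_coe_sort]
    simpa using h2

/-- The linear growth in n is the point: monomials in three generators grow quadratically, which
forces a relation. -/
theorem IsRegularPair.spanFinrank_pow_le [IsNoetherianRing R] {x y : R} (h : IsRegularPair x y)
    {J : Ideal R} {N : ℕ} (hN : maximalIdeal R ^ N ≤ J) (n : ℕ) :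
    (J ^ n).spanFinrank ≤ N * n + 1 := by
  have hpow : maximalIdeal R ^ (N * n) ≤ J ^ n := by
    rw [pow_mul]
    exact Ideal.pow_right_mono hN n
  have h1 := h.spanFinrank_le (J ^ n).fg_of_isNoetherianRing hpow h.left_mem
  have h2 : Ideal.span {x, y ^ (N * n)} ≤ J ^ n ⊔ Ideal.span {x} := by
    rw [Ideal.span_insert, sup_comm]
    exact sup_le_sup_right ((Ideal.span_singleton_le_iff_mem _).mpr
      (hpow (Ideal.pow_mem_pow h.right_mem _))) _
  have h3 := (Ideal.colength_anti h2).trans (Ideal.colength_span_pair_pow_le _ _ _)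
  rw [← h.maximalIdeal_eq, colength_maximalIdeal, mul_one] at h3
  have h4 : ((J ^ n).spanFinrank : ℕ∞) ≤ (N * n : ℕ) + 1 := h1.trans (add_le_add_left h3 1)
  exact_mod_cast h4

/-- One of three generators can be dropped, up to a reduction. -/
theorem IsRegularPair.exists_reduction_step [IsNoetherianRing R] [Infinite (ResidueField R)]
    {x y : R} (h : IsRegularPair x y) {J K : Ideal R} {a b c : R}
    (hJ : J = Ideal.span {a, b} ⊔ K ⊔ Ideal.span {c}) {N : ℕ} (hN : maximalIdeal R ^ N ≤ J) :
    ∃ a' b' n, J = Ideal.span {a', b'} ⊔ K ⊔ Ideal.span {c} ∧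
      J ^ (n + 1) ≤ (Ideal.span {a', b'} ⊔ K) * J ^ n := by
  classical
  have haJ : a ∈ J := hJ ▸ Ideal.mem_sup_left (Ideal.mem_sup_left (Ideal.subset_span (by simp)))
  have hbJ : b ∈ J := hJ ▸ Ideal.mem_sup_left (Ideal.mem_sup_left (Ideal.subset_span (by simp)))
  have hcJ : c ∈ J := hJ ▸ Ideal.mem_sup_right (Ideal.mem_span_singleton_self c)
  -- Chosen so that the p² monomials outnumber the at most 2Np + 1 generators of J^(2p); as i, j <
  -- p, the exponent of c is not truncated.
  let p := 2 * N + 2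
  let n := 2 * p - 1
  have hn : n + 1 = 2 * p := by omega
  let s := Finset.range p ×ˢ Finset.range p
  have hsum : ∀ q ∈ s, q.1 + q.2 + (n + 1 - q.1 - q.2) = n + 1 := by
    intro q hq
    have := Finset.mem_product.mp hq
    simp only [Finset.mem_range] at this
    omega
  obtain ⟨G, ⟨⟨i₀, j₀⟩, hij, hG⟩, hrel⟩ := exists_sum_mem_maximalIdeal_mul
    (J ^ (n + 1)).fg_of_isNoetherianRing s
    (fun q ↦ a ^ q.1 * b ^ q.2 * c ^ (n + 1 - q.1 - q.2))
    (fun q hq ↦ by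
      have := Ideal.mul_mem_mul (Ideal.mul_mem_mul (Ideal.pow_mem_pow haJ q.1)
        (Ideal.pow_mem_pow hbJ q.2)) (Ideal.pow_mem_pow hcJ (n + 1 - q.1 - q.2))
      rwa [← pow_add, ← pow_add, hsum q hq] at this)
    (by
      refine (h.spanFinrank_pow_le hN (n + 1)).trans_lt ?_
      rw [hn, Finset.card_product, Finset.card_range]
      simp only [p]
      nlinarith)
  obtain ⟨hi, hj⟩ := Finset.mem_product.mp hij
  -- Choose u, then v, so that the relation with c set to 1 does not vanish at (u, v) in the residue
  -- field.
  obtain ⟨u, hu⟩ := Field.exists_sum_mul_pow_ne_zero _ (fun i ↦ residue R (G (i, j₀))) hi hG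
  obtain ⟨v, hv⟩ := Field.exists_sum_mul_pow_ne_zero _
    (fun j ↦ ∑ i ∈ Finset.range p, residue R (G (i, j)) * u ^ i) hj hu
  obtain ⟨u, rfl⟩ := residue_surjective u
  obtain ⟨v, rfl⟩ := residue_surjective v
  set e := ∑ q ∈ s, G q * (u ^ q.1 * v ^ q.2) with he
  have hunit : IsUnit e := by
    by_contra hnu
    refine hv ?_
    have := (residue_eq_zero_iff e).mpr ((mem_maximalIdeal _).mpr hnu)
    rw [← this, he, map_sum, Finset.sum_product_right]
    refine Finset.sum_congr rfl fun j _ ↦ ?_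
    rw [Finset.sum_mul]
    refine Finset.sum_congr rfl fun i _ ↦ ?_
    simp only [map_mul, map_pow]
    ring
  set I := Ideal.span {a - u * c, b - v * c} ⊔ K with hI
  have haI : a - u * c ∈ I := Ideal.mem_sup_left (Ideal.subset_span (by simp))
  have hbI : b - v * c ∈ I := Ideal.mem_sup_left (Ideal.subset_span (by simp))
  have hJI : J = I ⊔ Ideal.span {c} := by
    have hcI : c ∈ I ⊔ Ideal.span {c} := Ideal.mem_sup_right (Ideal.mem_span_singleton_self c)
    refine le_antisymm ?_ ?_
    · rw [hJ]
      refine sup_le (sup_le (Ideal.span_le.mpr ?_) (le_sup_right.trans le_sup_left)) le_sup_right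
      rintro _ (rfl | rfl)
      · have := add_mem (Ideal.mem_sup_left haI) (Ideal.mul_mem_left _ u hcI)
        simpa using this
      · have := add_mem (Ideal.mem_sup_left hbI) (Ideal.mul_mem_left _ v hcI)
        simpa using this
    · refine sup_le (sup_le (Ideal.span_le.mpr ?_) ?_)
        ((Ideal.span_singleton_le_iff_mem _).mpr hcJ)
      · rintro _ (rfl | rfl)
        exacts [sub_mem haJ (J.mul_mem_left _ hcJ), sub_mem hbJ (J.mul_mem_left _ hcJ)]
      · rw [hJ]
        exact le_sup_right.trans le_sup_left
  refine ⟨a - u * c, b - v * c, n, hJI, ?_⟩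
  -- By Nakayama it suffices to work modulo 𝔪J^(n+1). Only c^(n+1) is left to treat: modulo I·J^n
  -- the relation becomes e·c^(n+1), with e a unit.
  refine Submodule.le_of_le_smul_of_le_jacobson_bot (I := maximalIdeal R)
    (J ^ (n + 1)).fg_of_isNoetherianRing (jacobson_eq_maximalIdeal _ bot_ne_top).ge ?_
  have h1 := Ideal.sup_span_singleton_pow_succ_le I c n
  rw [← hJI] at h1
  refine h1.trans (sup_le le_sup_left ((Ideal.span_singleton_le_iff_mem _).mpr ?_))
  have h2 : ∑ q ∈ s, G q * (a ^ q.1 * b ^ q.2 * c ^ (n + 1 - q.1 - q.2)) - e * c ^ (n + 1) ∈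
      I * J ^ n := by
    rw [he, Finset.sum_mul, ← Finset.sum_sub_distrib]
    refine sum_mem fun q hq ↦ ?_
    rw [mul_assoc (G q), ← mul_sub]
    exact Ideal.mul_mem_left _ _
      (Ideal.monomial_sub_mem_mul_pow haJ hbJ hcJ haI hbI (hsum q hq))
  obtain ⟨f, hf⟩ := hunit.exists_left_inv
  have h3 : c ^ (n + 1) = f * (∑ q ∈ s, G q * (a ^ q.1 * b ^ q.2 * c ^ (n + 1 - q.1 - q.2)) -
      (∑ q ∈ s, G q * (a ^ q.1 * b ^ q.2 * c ^ (n + 1 - q.1 - q.2)) - e * c ^ (n + 1))) := by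
    linear_combination (-c ^ (n + 1)) * hf
  rw [h3]
  exact Ideal.mul_mem_left _ _ (sub_mem (Ideal.mem_sup_right hrel) (Ideal.mem_sup_left h2))

theorem Ideal.pow_add_le_pow_of_pow_succ_le {R : Type*} [CommRing R] {I J : Ideal R} {n : ℕ}
    (h : J ^ (n + 1) ≤ I * J ^ n) (k : ℕ) : J ^ (k + n) ≤ I ^ k := by
  have key : J ^ (k + n) ≤ I ^ k * J ^ n := by
    induction k with
    | zero => simp
    | succ k ih =>
      calc J ^ (k + 1 + n) = J ^ k * J ^ (n + 1) := by rw [← pow_add]; congr 1; omega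
        _ ≤ J ^ k * (I * J ^ n) := Ideal.mul_mono_right h
        _ = I * J ^ (k + n) := by rw [pow_add]; ring
        _ ≤ I * (I ^ k * J ^ n) := Ideal.mul_mono_right ih
        _ = I ^ (k + 1) * J ^ n := by ring
  exact key.trans Ideal.mul_le_left

/-- Absorb the generators one at a time into a pair; each smaller ideal still contains a power of 𝔪,
and the exponent shifts add up. -/
theorem IsRegularPair.exists_two_generated_reduction [IsNoetherianRing R]
    [Infinite (ResidueField R)] {x y : R} (h : IsRegularPair x y) {J : Ideal R} {N : ℕ}
    (hN : maximalIdeal R ^ N ≤ J) :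
    ∃ a b C, Ideal.span {a, b} ≤ J ∧ ∀ n, J ^ (n + C) ≤ Ideal.span {a, b} ^ n := by
  classical
  have key : ∀ (T : Finset R) (a b : R) (J : Ideal R), J = Ideal.span {a, b} ⊔ Ideal.span T →
      ∀ N, maximalIdeal R ^ N ≤ J →
      ∃ a b C, Ideal.span {a, b} ≤ J ∧ ∀ n, J ^ (n + C) ≤ Ideal.span {a, b} ^ n := by
    intro T
    induction T using Finset.induction_on with
    | empty =>
      rintro a b _ rfl N -
      exact ⟨a, b, 0, le_sup_left, fun n ↦ by simp⟩
    | insert c T _ ih =>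
      intro a b J hJ N hN
      rw [Finset.coe_insert, Ideal.span_insert c, sup_comm (Ideal.span {c}), ← sup_assoc] at hJ
      obtain ⟨a', b', n, hJ', hn⟩ := h.exists_reduction_step hJ hN
      have hpow := Ideal.pow_add_le_pow_of_pow_succ_le hn
      obtain ⟨a'', b'', C, hle, hC⟩ := ih a' b' _ rfl (N * (1 + n)) (by
        rw [pow_mul]
        exact (Ideal.pow_right_mono hN _).trans ((hpow 1).trans (pow_one _).le))
      refine ⟨a'', b'', C + n, hle.trans (hJ' ▸ le_sup_left), fun k ↦ ?_⟩
      rw [← add_assoc]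
      exact (hpow _).trans (hC k)
  obtain ⟨T, hT⟩ := J.fg_of_isNoetherianRing
  -- The pair starts as (0, 0) and acquires multiples of the generators as they are dropped.
  refine key T 0 0 J ?_ N hN
  simp [← hT]

end Reduction

/-! ### Hilbert–Samuel function of a parameter ideal -/

section RegularSequence

variable {R : Type*} [CommRing R]

theorem Ideal.colength_span_pair_pow {a b : R} (hab : ∀ c, b ∣ a * c → b ∣ c) (n : ℕ) :
    (Ideal.span {b, a ^ n}).colength = n * (Ideal.span {b, a}).colength := by
  refine le_antisymm (Ideal.colength_span_pair_pow_le b a n) ?_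
  induction n with
  | zero => simp
  | succ n ih =>
    have hcolon : (Ideal.span {b, a ^ (n + 1)}).colon {a} ≤ Ideal.span {b, a ^ n} := by
      intro r hr
      obtain ⟨s, t, hst⟩ := Ideal.mem_span_pair.mp (Submodule.mem_colon_singleton.mp hr)
      rw [smul_eq_mul] at hst
      obtain ⟨d, hd⟩ := hab (r - t * a ^ n) ⟨s, by linear_combination -hst⟩
      exact Ideal.mem_span_pair.mpr ⟨d, t, by linear_combination -hd⟩
    have hsup : Ideal.span {b, a ^ (n + 1)} ⊔ Ideal.span {a} ≤ Ideal.span {b, a} := by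
      refine sup_le (Ideal.span_le.mpr ?_) (Ideal.span_mono (by simp))
      rintro _ (rfl | rfl)
      · exact Ideal.subset_span (by simp)
      · exact Ideal.pow_mem_of_mem _ (Ideal.subset_span (by simp)) _ n.succ_pos
    rw [Ideal.colength_eq_colon_add (Ideal.span {b, a ^ (n + 1)}) a]
    push_cast
    rw [add_mul, one_mul]
    exact add_le_add (ih.trans (Ideal.colength_anti hcolon)) (Ideal.colength_anti hsup)

/-- The Hilbert-Samuel function of an ideal generated by a regular sequence of length two. -/
theorem Ideal.colength_span_pair_pow_mul_two {a b : R} (hb : ∀ c, b * c = 0 → c = 0)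
    (hab : ∀ c, b ∣ a * c → b ∣ c) (n : ℕ) :
    (Ideal.span {b, a} ^ n).colength * 2 = (Ideal.span {b, a}).colength * (n * (n + 1) : ℕ) := by
  set Q := Ideal.span {b, a} with hQ
  have hbQ : b ∈ Q := Ideal.subset_span (by simp)
  have haQ : a ∈ Q := Ideal.subset_span (by simp)
  induction n with
  | zero => simp [Ideal.colength_top]
  | succ n ih =>
    have hpow : Q ^ (n + 1) ≤ Ideal.span {b} * Q ^ n ⊔ Ideal.span {a ^ (n + 1)} := by
      have := Ideal.sup_span_singleton_pow_succ_le (Ideal.span {b}) a n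
      rwa [← Ideal.span_insert, ← hQ] at this
    have hdvd : ∀ k c, b ∣ a ^ k * c → b ∣ c := by
      intro k
      induction k with
      | zero => simp
      | succ k ihk => exact fun c hc ↦ ihk c (hab _ (by rwa [pow_succ', mul_assoc] at hc))
    -- If rb = bg + a^(n+1)t with g ∈ Q^n, then b divides t because a is regular modulo b; cancel b.
    have hcolon : (Q ^ (n + 1)).colon {b} = Q ^ n := by
      refine le_antisymm (fun r hr ↦ ?_) fun r hr ↦ Submodule.mem_colon_singleton.mpr ?_
      · obtain ⟨_, hbg, _, ht, hgt⟩ :=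
          Submodule.mem_sup.mp (hpow (Submodule.mem_colon_singleton.mp hr))
        obtain ⟨g, hg, rfl⟩ := Ideal.mem_span_singleton_mul.mp hbg
        obtain ⟨t, rfl⟩ := Ideal.mem_span_singleton.mp ht
        rw [smul_eq_mul] at hgt
        obtain ⟨t, rfl⟩ := hdvd (n + 1) t ⟨r - g, by linear_combination hgt⟩
        have h0 := hb (r - g - a ^ (n + 1) * t) (by linear_combination -hgt)
        have h1 : r = g + a ^ n * (a * t) := by linear_combination h0
        rw [h1]
        exact add_mem hg (Ideal.mul_mem_right _ _ (Ideal.pow_mem_pow haQ n))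
      · exact pow_succ Q n ▸ Ideal.mul_mem_mul hr hbQ
    have hsup : Q ^ (n + 1) ⊔ Ideal.span {b} = Ideal.span {b, a ^ (n + 1)} := by
      rw [Ideal.span_insert, sup_comm (Ideal.span {b})]
      refine le_antisymm (sup_le (hpow.trans ?_) le_sup_right) (sup_le_sup_right ?_ _)
      · rw [sup_comm]
        exact sup_le_sup_left Ideal.mul_le_left _
      · exact (Ideal.span_singleton_le_iff_mem _).mpr (Ideal.pow_mem_pow haQ _)
    rw [Ideal.colength_eq_colon_add _ b, hcolon, hsup, Ideal.colength_span_pair_pow hab, ← hQ,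
      add_mul, ih]
    push_cast
    ring

/-- The generators form a regular sequence: b ∣ ac implies (a,b)c ⊆ (b), hence 𝔪^N c ⊆ (b), and
depth two gives b ∣ c. -/
theorem IsRegularPair.colength_pow_mul_two [IsLocalRing R] [IsDomain R] {x y : R}
    (h : IsRegularPair x y) {a b : R} (hQ : Ideal.span {a, b} ≤ maximalIdeal R) {N : ℕ}
    (hN : maximalIdeal R ^ N ≤ Ideal.span {a, b}) (n : ℕ) :
    (Ideal.span {a, b} ^ n).colength * 2 = (Ideal.span {a, b}).colength * (n * (n + 1) : ℕ) := by
  have hb0 : b ≠ 0 := by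
    rintro rfl
    refine h.not_pow_le_span_singleton (b := a) (hQ (Ideal.subset_span (by simp))) N ?_
    rw [Set.pair_comm, Ideal.span_insert] at hN
    simpa using hN
  have hb : ∀ c, b * c = 0 → c = 0 := fun c hc ↦ (mul_eq_zero.mp hc).resolve_left hb0
  rw [Set.pair_comm]
  refine Ideal.colength_span_pair_pow_mul_two hb (fun c hc ↦ ?_) n
  refine h.dvd_of_forall_mem hb N c fun r hr ↦ ?_
  obtain ⟨s, t, rfl⟩ := Ideal.mem_span_pair.mp (hN hr)
  have h1 : (s * a + t * b) * c = s * (a * c) + b * (t * c) := by ring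
  rw [h1]
  exact dvd_add (hc.mul_left s) (dvd_mul_right _ _)

end RegularSequence

/-! ### Limits of quadratic bounds -/

section Limit

theorem tendsto_two_mul_div_sq {f : ℕ → ℕ} {q C : ℕ} (hu : ∀ n, f n * 2 ≤ q * (n * (n + 1)))
    (hl : ∀ n, q * (n * (n + 1)) ≤ f (n + C) * 2) :
    Tendsto (fun n : ℕ ↦ (2 * f n / (n : ℝ) ^ 2 : ℝ)) atTop (𝓝 q) := by
  have hinv : Tendsto (fun n : ℕ ↦ ((n : ℝ))⁻¹) atTop (𝓝 0) :=
    tendsto_inv_atTop_zero.comp tendsto_natCast_atTop_atTop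
  have hup : Tendsto (fun n : ℕ ↦ (q * (1 + (n : ℝ)⁻¹) : ℝ)) atTop (𝓝 q) := by
    simpa using (hinv.const_add 1).const_mul (q : ℝ)
  have hlow : Tendsto (fun n : ℕ ↦ (q * (1 - C * (n : ℝ)⁻¹) ^ 2 : ℝ)) atTop (𝓝 q) := by
    simpa using (((hinv.const_mul (C : ℝ)).const_sub 1).pow 2).const_mul (q : ℝ)
  refine tendsto_of_tendsto_of_tendsto_of_le_of_le' hlow hup ?_ ?_
  · filter_upwards [eventually_ge_atTop (C + 1)] with n hn
    -- With m = n - C, the lower bound is q·m² ≤ q·m(m+1).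
    obtain ⟨m, rfl⟩ := Nat.exists_eq_add_of_le' (show C ≤ n by omega)
    have h0 : (0 : ℝ) < ((m + C : ℕ) : ℝ) := by exact_mod_cast (by omega : 0 < m + C)
    have h1 : (q : ℝ) * (m * (m + 1)) ≤ f (m + C) * 2 := by exact_mod_cast hl m
    have h2 : (1 - C * ((m + C : ℕ) : ℝ)⁻¹ : ℝ) = m / ((m + C : ℕ) : ℝ) := by
      field_simp
      push_cast
      ring
    rw [h2, div_pow, ← mul_div_assoc]
    refine div_le_div_of_nonneg_right ?_ (by positivity)
    have h3 : (0 : ℝ) ≤ q * m := by positivity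
    linarith
  · filter_upwards [eventually_ge_atTop 1] with n hn
    have h0 : (0 : ℝ) < n := by exact_mod_cast hn
    have h1 : (f n : ℝ) * 2 ≤ q * (n * (n + 1)) := by exact_mod_cast hu n
    rw [div_le_iff₀ (by positivity)]
    have h2 : (q * (1 + (n : ℝ)⁻¹) * (n : ℝ) ^ 2 : ℝ) = q * (n * (n + 1)) := by
      field_simp
    rw [h2]
    linarith

theorem le_of_tendsto_two_mul_div_sq {f : ℕ → ℕ} {e L : ℝ}
    (hf : Tendsto (fun n : ℕ ↦ (2 * f n / (n : ℝ) ^ 2 : ℝ)) atTop (𝓝 e))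
    (hL : ∀ n : ℕ, (f n * 2 : ℝ) ≤ L * (n * (n + 1))) : e ≤ L := by
  have hinv : Tendsto (fun n : ℕ ↦ ((n : ℝ))⁻¹) atTop (𝓝 0) :=
    tendsto_inv_atTop_zero.comp tendsto_natCast_atTop_atTop
  have hup : Tendsto (fun n : ℕ ↦ (L * (1 + (n : ℝ)⁻¹) : ℝ)) atTop (𝓝 L) := by
    simpa using (hinv.const_add 1).const_mul L
  refine le_of_tendsto_of_tendsto hf hup ?_
  filter_upwards [eventually_ge_atTop 1] with n hn
  have h0 : (0 : ℝ) < n := by exact_mod_cast hn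
  have h1 := hL n
  rw [div_le_iff₀ (by positivity)]
  have h2 : (L * (1 + (n : ℝ)⁻¹) * (n : ℝ) ^ 2 : ℝ) = L * (n * (n + 1)) := by
    field_simp
  rw [h2]
  linarith

end Limit

/-! ### Assembly over R -/

section Main

variable {R : Type u} [CommRing R]

theorem IsRegularPair.exists_tendsto_colength_pow [IsLocalRing R] [IsNoetherianRing R] [IsDomain R]
    {x y : R} (h : IsRegularPair x y) {I : Ideal R} (hI : I ≤ maximalIdeal R) {N : ℕ}
    (hN : maximalIdeal R ^ N ≤ I) :
    ∃ q : ℕ, Tendsto (fun n : ℕ ↦ (2 * (I ^ n).colength.toNat / (n : ℝ) ^ 2 : ℝ)) atTop (𝓝 q) := by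
  obtain ⟨S, _, _, _, _, _, _, _, hS⟩ := exists_flat_infinite_residueField R
  have hpair := h.map S hS
  have hNS := maximalIdeal_pow_le_map hS hN
  obtain ⟨a, b, C, hle, hC⟩ := hpair.exists_two_generated_reduction hNS
  have hIS : I.map (algebraMap R S) ≤ maximalIdeal S := hS ▸ Ideal.map_mono hI
  have hNQ : maximalIdeal S ^ (N * (1 + C)) ≤ Ideal.span {a, b} := by
    rw [pow_mul]
    exact (Ideal.pow_right_mono hNS _).trans ((hC 1).trans (pow_one _).le)
  have hQ := hpair.colength_pow_mul_two (hle.trans hIS) hNQ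
  have hqfin := colength_ne_top_of_pow_le hpair.maximalIdeal_eq hNQ
  obtain ⟨q, hq⟩ := ENat.ne_top_iff_exists.mp hqfin
  have hfin : ∀ n, ((I ^ n).colength.toNat : ℕ∞) = (I ^ n).colength := fun n ↦
    ENat.natCast_toNat (colength_ne_top_of_pow_le h.maximalIdeal_eq (n := N * n)
      (by rw [pow_mul]; exact Ideal.pow_right_mono hN n))
  have hmap : ∀ n, (I.map (algebraMap R S) ^ n).colength = (I ^ n).colength := fun n ↦ by
    rw [← Ideal.map_pow, colength_map hS]
  refine ⟨q, tendsto_two_mul_div_sq (C := C) (fun n ↦ ?_) (fun n ↦ ?_)⟩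
  · have h1 := Ideal.colength_anti (Ideal.pow_right_mono hle n)
    rw [hmap, ← hfin] at h1
    have h2 : ((I ^ n).colength.toNat : ℕ∞) * 2 ≤ q * (n * (n + 1) : ℕ) := by
      rw [hq, ← hQ]
      gcongr
    exact_mod_cast h2
  · have h1 := Ideal.colength_anti (hC n)
    rw [hmap, ← hfin] at h1
    have h2 : (q : ℕ∞) * (n * (n + 1) : ℕ) ≤ ((I ^ (n + C)).colength.toNat : ℕ∞) * 2 := by
      rw [hq, ← hQ]
      gcongr
    exact_mod_cast h2

/-- All quantities involved descend from S. The second bound is stated additively to avoid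
subtracting in `ℕ∞`. -/
theorem IsRegularPair.bounds_of_isFull [IsLocalRing R] [IsNoetherianRing R] {x y : R}
    (h : IsRegularPair x y) {I : Ideal R} {n : ℕ} (hn : maximalIdeal R ^ n ≤ I)
    (hfull : IsFull.{u, v} I) :
    (∀ s, I ≤ maximalIdeal R ^ s → s + 1 ≤ I.spanFinrank) ∧
    ∀ k : ℕ, (I ^ k).colength * 2 + n * (k * (k + 1) : ℕ) ≤
      n * I.spanFinrank * (k * (k + 1) : ℕ) := by
  obtain hfull | ⟨S, _, _, _, _, _, _, hS, hfull⟩ := hfull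
  · exact h.bounds_of_hasFullElement hn hfull
  · have hfin := colength_ne_top_of_pow_le h.maximalIdeal_eq hn
    obtain ⟨h1, h2⟩ :=
      (h.map S hS).bounds_of_hasFullElement (maximalIdeal_pow_le_map hS hn) hfull
    rw [spanFinrank_map hS I.fg_of_isNoetherianRing hfin] at h1 h2
    refine ⟨fun s hs ↦ h1 s ((map_le_maximalIdeal_pow_iff hS I s).mpr hs), fun k ↦ ?_⟩
    have := h2 k
    rwa [← Ideal.map_pow, colength_map hS] at this

theorem IsRegularPair.exists_le_pow_spanFinrank_le [IsLocalRing R] [IsNoetherianRing R] [IsDomain R]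
    {x y : R} (h : IsRegularPair x y) {I : Ideal R} {n : ℕ} (hn : maximalIdeal R ^ n ≤ I) :
    ∃ s, I ≤ maximalIdeal R ^ s ∧ I.spanFinrank ≤ s + 1 := by
  obtain ⟨S, _, _, _, _, _, _, _, hS⟩ := exists_flat_infinite_residueField R
  obtain ⟨s, hs, hμ⟩ := (h.map S hS).exists_spanFinrank_le (maximalIdeal_pow_le_map hS hn)
  have hfin := colength_ne_top_of_pow_le h.maximalIdeal_eq hn
  rw [spanFinrank_map hS I.fg_of_isNoetherianRing hfin] at hμ
  exact ⟨s, (map_le_maximalIdeal_pow_iff hS I s).mp hs, hμ⟩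

/-- The s with μ ≤ s + 1 is the order, because fullness bounds every admissible exponent by μ - 1.
-/
theorem IsRegularPair.spanFinrank_eq_idealOrder_add_one [IsLocalRing R] [IsNoetherianRing R]
    [IsDomain R] {x y : R} (h : IsRegularPair x y) {I : Ideal R} {n : ℕ}
    (hn : maximalIdeal R ^ n ≤ I) (hfull : IsFull.{u, v} I) :
    I.spanFinrank = idealOrder I + 1 := by
  obtain ⟨h1, -⟩ := h.bounds_of_isFull hn hfull
  obtain ⟨s, hs, hμ⟩ := h.exists_le_pow_spanFinrank_le hn
  have hs' := h1 s hs
  have : IsGreatest {s : ℕ | I ≤ maximalIdeal R ^ s} s :=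
    ⟨hs, fun t ht ↦ by have := h1 t ht; omega⟩
  rw [idealOrder, this.csSup_eq]
  omega

theorem normalizedHilbertSamuel_eq_of_ringKrullDim_eq_two (hdim : ringKrullDim R = 2)
    (I : Ideal R) : normalizedHilbertSamuel I =
      fun n : ℕ ↦ (2 * (I ^ n).colength.toNat / (n : ℝ) ^ 2 : ℝ) := by
  have hd : ((ringKrullDim R).unbotD 0).toNat = 2 := by
    rw [hdim]
    rfl
  funext n
  simp only [normalizedHilbertSamuel, hd, Nat.factorial_two, Ideal.colength]
  norm_num

end Main

theorem mainTheorem5 (R : Type u) [CommRing R] [IsRegularLocalRing R]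
    (hdim : ringKrullDim R = 2) (I : Ideal R)
    (hprimary : I.IsPrimary) (hrad : I.radical = maximalIdeal R)
    (hfull : IsFull.{u, v} I) :
    Tendsto (normalizedHilbertSamuel I) atTop (𝓝 (hilbertSamuelMultiplicity I)) ∧
    hilbertSamuelMultiplicity I ≤
      (loewyLength I : ℝ) * ((Submodule.spanFinrank I : ℝ) - 1) ∧
    (loewyLength I : ℝ) * ((Submodule.spanFinrank I : ℝ) - 1) =
      (loewyLength I : ℝ) * (idealOrder I : ℝ) := by
  obtain ⟨_, x, y, h⟩ := IsRegularLocalRing.exists_isRegularPair R hdim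
  have hI : I ≤ maximalIdeal R := hrad ▸ Ideal.le_radical
  have hll : maximalIdeal R ^ loewyLength I ≤ I := by
    refine Nat.sInf_mem (s := {n : ℕ | maximalIdeal R ^ n ≤ I}) ?_
    obtain ⟨N, hN⟩ := I.exists_radical_pow_le_of_fg I.radical.fg_of_isNoetherianRing
    exact ⟨N, by rwa [hrad] at hN⟩
  obtain ⟨q, hq⟩ := h.exists_tendsto_colength_pow hI hll
  rw [← normalizedHilbertSamuel_eq_of_ringKrullDim_eq_two hdim] at hq
  have hlim : Tendsto (normalizedHilbertSamuel I) atTop (𝓝 (hilbertSamuelMultiplicity I)) := by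
    rwa [hilbertSamuelMultiplicity, hq.limUnder_eq]
  refine ⟨hlim, ?_, ?_⟩
  · rw [normalizedHilbertSamuel_eq_of_ringKrullDim_eq_two hdim] at hlim
    refine le_of_tendsto_two_mul_div_sq hlim fun k ↦ ?_
    have h1 := (h.bounds_of_isFull hll hfull).2 k
    have hfin : ((I ^ k).colength.toNat : ℕ∞) = (I ^ k).colength :=
      ENat.natCast_toNat (colength_ne_top_of_pow_le h.maximalIdeal_eq (n := loewyLength I * k)
        (by rw [pow_mul]; exact Ideal.pow_right_mono hll k))
    rw [← hfin] at h1
    have h2 : (I ^ k).colength.toNat * 2 + loewyLength I * (k * (k + 1)) ≤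
        loewyLength I * I.spanFinrank * (k * (k + 1)) := by exact_mod_cast h1
    have h3 : ((I ^ k).colength.toNat * 2 + loewyLength I * (k * (k + 1)) : ℝ) ≤
        loewyLength I * I.spanFinrank * (k * (k + 1)) := by exact_mod_cast h2
    linarith
  · rw [h.spanFinrank_eq_idealOrder_add_one hll hfull]
    push_cast
    ring
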